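/- **Setting.** Let $n\ge 0$, $q\ge 1$, and label the computational basis of a qudit of local dimension $q$ by a finite abelian group $G$ with $|G|=q$ (for instance $G=\mathbb Z/q$, or $G=\mathbb F_q$ for a prime power $q$). Let $\mathcal H=(\mathbb C^{q})^{\otimes n}$ be the space of $n$ qudits. The Pauli group consists of the operators $z\bigotimes_{i=1}^n X(a_i)Z(\chi_i)$, where $|z|=1$, $a_i\in G$, $\chi_i$ is a character of $G$, $X(a)|y\rangle=|y+a\rangle$ and $Z(\chi)|y\rangle=\chi(y)|y\rangle$. A *stabilizer code* is the simultaneous $+1$ eigenspace of all elements of an abelian subgroup of the Pauli group. A *code* is a nonzero subspace $\mathcal C\subseteq\mathcal H$ (an $[[n,k,d]]_q$ code if $\dim\mathcal C=q^k$ and its distance is $d$; no condition is imposed on $\dim\mathcal C$ or $d$). Given a partition $\mathcal K=\{A_1,\dots,A_m\}$ of the $n$ qudits, $\mathcal C$ has *trivial $m$-partite non-local magic* over $\mathcal K$ if there is a unitary $U=U_{A_1}\otimes\dots\otimes U_{A_m}$, with $U_{A_i}$ unitary on the qudits of $A_i$, such that $U\mathcal C$ is a stabilizer code. For a set $A$ of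 qudits with complement $\bar A$, write $\mathcal H=\mathcal H_A\otimes\mathcal H_{\bar A}$ and let $M_A\subseteq L(\mathcal C)$ be the algebra of those $T$ for which some $O\in L(\mathcal H_A)$ satisfies $(O\otimes 1)|\psi\rangle=T|\psi\rangle$ and $(O^\dagger\otimes 1)|\psi\rangle=T^\dagger|\psi\rangle$ for all $|\psi\rangle\in\mathcal C$. An *area operator* of $\mathcal C$ for $A,\bar A$ is an operator $\mathcal L_A\in L(\mathcal C)$ that arises as follows: * (complementary recovery) $M_A'\subseteq M_{\bar A}$, where $M_A'$ is the commutant of $M_A$ in $L(\mathcal C)$; * $\mathcal C=\bigoplus_\alpha \mathcal H_{a^\alpha}\otimes\mathcal H_{\bar a^\alpha}$ has an orthonormal basis $|\widetilde{\alpha,ij}\rangle$ adapted to $M_A=\bigoplus_\alpha L(\mathcal H_{a^\alpha})\otimes 1_{\bar a^\alpha}$; * there are isometries $U_A:\bigoplus_\alpha \mathcal H_{A_1^\alpha}\otimes\mathcal H_{A_2^\alpha}\to\mathcal H_A$ and $U_{\bar A}:\bigoplus_\alpha \mathcal H_{\bar A_1^\alpha}\otimes\mathcal H_{\bar A_2^\alpha}\to\mathcal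 H_{\bar A}$ and unit vectors $|\chi_\alpha\rangle\in\mathcal H_{A_2^\alpha}\otimes\mathcal H_{\bar A_2^\alpha}$ with $|\widetilde{\alpha,ij}\rangle=U_AU_{\bar A}\big(|\alpha,i\rangle_{A_1^\alpha}|\alpha,j\rangle_{\bar A_1^\alpha}|\chi_\alpha\rangle_{A_2^\alpha\bar A_2^\alpha}\big)$ for all $\alpha,i,j$; * $\mathcal L_A=\bigoplus_\alpha S(\chi_\alpha)\,1_{a^\alpha\bar a^\alpha}$, where $S(\chi_\alpha)$ is the von Neumann entropy of $\chi_\alpha=\operatorname{Tr}_{\bar A_2^\alpha}|\chi_\alpha\rangle\langle\chi_\alpha|$. **Corollary.** Let $\mathcal K$ be a partition of the $n$ physical qudits and $\mathcal C$ a code with trivial $m$-partite non-local magic over $\mathcal K$. Let $A$ be the union of the members of any subset $\mathcal K_A\subseteq\mathcal K$. Then $\mathcal C$ has an area operator for the bipartition $A,\bar A$, and every such area operator is trivial, i.e. proportional to the identity of $\mathcal C$. -/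

import Mathlib

/-! Quantum codes on `n` qudits. The computational basis of one qudit of local dimension `q` is
labelled by a finite abelian group `G` of order `q`; `G = ZMod q` gives the usual qudit Pauli
(Weyl-Heisenberg) operators and `G = 𝔽_q` the finite-field ones. -/

namespace QCode

open Matrix

/-- The `n`-qudit Hilbert space `(ℂ^q)^{⊗ n}`, `q = |G|`. -/
abbrev Hilb (n : ℕ) (G : Type*) := EuclideanSpace ℂ (Fin n → G)

/-- The Hilbert space `H_A` of the qudits in the region `A`. -/
abbrev RegionHilb {n : ℕ} (A : Finset (Fin n)) (G : Type*) := EuclideanSpace ℂ (A → G)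

/-- The restriction of a computational basis label to the region `A`. -/
def res {n : ℕ} {G : Type*} (A : Finset (Fin n)) (x : Fin n → G) : A → G := fun i => x i

section Pauli

variable {n : ℕ} {G : Type*} [AddCommGroup G] [Fintype G] [DecidableEq G]

/-- The Pauli operator `⊗ᵢ X(aᵢ) Z(χᵢ)`, where `X(a)|y⟩ = |y + a⟩` and `Z(χ)|y⟩ = χ(y)|y⟩`. -/
noncomputable def pauli (a : Fin n → G) (χ : Fin n → AddChar G ℂ) :
    Matrix (Fin n → G) (Fin n → G) ℂ :=
  Matrix.of fun x y => ∏ i, if x i = y i + a i then χ i (y i) else 0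

/-- Elements of the `n`-qudit Pauli group: phases times Pauli operators. All phases of modulus
one are allowed; a Pauli operator that has a `+1` eigenvector always has a root of unity as its
phase. -/
def IsPauli (P : Matrix (Fin n → G) (Fin n → G) ℂ) : Prop :=
  ∃ (z : ℂ) (a : Fin n → G) (χ : Fin n → AddChar G ℂ), ‖z‖ = 1 ∧ P = z • pauli a χ

/-- A stabilizer code: the simultaneous `+1` eigenspace of all elements of an abelian subgroup
`S` of the Pauli group. -/
def IsStabilizerCode (C : Submodule ℂ (Hilb n G)) : Prop :=
  ∃ S : Subgroup (Matrix.unitaryGroup (Fin n → G) ℂ),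
    (∀ g ∈ S, IsPauli (g : Matrix (Fin n → G) (Fin n → G) ℂ)) ∧
    (∀ g ∈ S, ∀ h ∈ S, g * h = h * g) ∧
    ∀ ψ : Hilb n G, ψ ∈ C ↔
      ∀ g ∈ S, Matrix.toEuclideanLin (g : Matrix (Fin n → G) (Fin n → G) ℂ) ψ = ψ

/-- The operator `⊗_{B ∈ K} U_B` for a partition `K` of the qudits. -/
noncomputable def tensorOver (K : Finpartition (Finset.univ : Finset (Fin n)))
    (U : ∀ B : Finset (Fin n), Matrix (B → G) (B → G) ℂ) :
    Matrix (Fin n → G) (Fin n → G) ℂ :=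
  Matrix.of fun x y => ∏ B ∈ K.parts, U B (res B x) (res B y)

/-- The code `C` has trivial non-local magic over the partition `K`: some unitary
`⊗_{B ∈ K} U_B` deforms it to a stabilizer code. -/
def HasTrivialNonlocalMagic (K : Finpartition (Finset.univ : Finset (Fin n)))
    (C : Submodule ℂ (Hilb n G)) : Prop :=
  ∃ U : ∀ B : Finset (Fin n), Matrix (B → G) (B → G) ℂ,
    (∀ B ∈ K.parts, U B ∈ Matrix.unitaryGroup (B → G) ℂ) ∧
    IsStabilizerCode (C.map (Matrix.toEuclideanLin (tensorOver K U)))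

end Pauli

section Area

variable {n : ℕ} {G : Type*} [Fintype G] [DecidableEq G]

/-- The operator `O ⊗ 1` on `H = H_A ⊗ H_{Aᶜ}`. -/
def onRegion (A : Finset (Fin n)) (O : Matrix (A → G) (A → G) ℂ) :
    Matrix (Fin n → G) (Fin n → G) ℂ :=
  Matrix.of fun x y => if res Aᶜ x = res Aᶜ y then O (res A x) (res A y) else 0

/-- The product vector `φ ⊗ ψ ∈ H_A ⊗ H_{Aᶜ} = H`. -/
noncomputable def prodVec (A : Finset (Fin n)) (φ : RegionHilb A G) (ψ : RegionHilb Aᶜ G) :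
    Hilb n G :=
  WithLp.toLp 2 fun x => φ (res A x) * ψ (res Aᶜ x)

/-- The code subalgebra `M_A`: the logical operators `T` that are implemented, together with
their adjoint, by an operator on `A`. -/
def codeAlgebra (C : Submodule ℂ (Hilb n G)) (A : Finset (Fin n)) : Set (Module.End ℂ C) :=
  {T | ∃ O : Matrix (A → G) (A → G) ℂ, ∀ ψ : C,
    Matrix.toEuclideanLin (onRegion A O) (ψ : Hilb n G) = (T ψ : Hilb n G) ∧
    Matrix.toEuclideanLin (onRegion A Oᴴ) (ψ : Hilb n G) = (LinearMap.adjoint (𝕜 := ℂ) (E := C) (F := C) T ψ : Hilb n G)}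

/-- The reduced density matrix on the first factor of a vector in `ℂ^c ⊗ ℂ^d`. -/
noncomputable def reduced {c d : ℕ} (χ : EuclideanSpace ℂ (Fin c × Fin d)) :
    Matrix (Fin c) (Fin c) ℂ :=
  Matrix.of fun k k' => ∑ l, χ (k, l) * star (χ (k', l))

theorem reduced_isHermitian {c d : ℕ} (χ : EuclideanSpace ℂ (Fin c × Fin d)) :
    (reduced χ).IsHermitian := by
  ext k k'
  simp [reduced, Matrix.conjTranspose_apply, mul_comm]

/-- The von Neumann entropy `-Tr ρ log ρ` of the reduced state `ρ` of `χ`. -/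
noncomputable def entropy {c d : ℕ} (χ : EuclideanSpace ℂ (Fin c × Fin d)) : ℝ :=
  ∑ k, Real.negMulLog ((reduced_isHermitian χ).eigenvalues k)

/-- Complementary recovery of the code `C` for the bipartition `A, Aᶜ`, with a choice of the
decomposition that it induces. The sectors `α` are labelled by `Fin r`; the spaces
`H_{A₁^α}, H_{Ā₁^α}, H_{A₂^α}, H_{Ā₂^α}` have dimensions `a α, b α, c α, d α`. Neither
`⊕_α H_{A₁^α} ⊗ H_{A₂^α}` nor its analogue for `Aᶜ` has to fill `H_A` or `H_{Aᶜ}`, hence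
isometries `UA`, `UB`. -/
structure RecoveryDecomposition (C : Submodule ℂ (Hilb n G)) (A : Finset (Fin n)) where
  r : ℕ
  a : Fin r → ℕ
  b : Fin r → ℕ
  c : Fin r → ℕ
  d : Fin r → ℕ
  /-- Complementary recovery: `M_A' ⊆ M_{Aᶜ}`. -/
  recovery : Set.centralizer (codeAlgebra C A) ⊆ codeAlgebra C Aᶜ
  /-- An orthonormal basis `|α, i j⟩` of the code, `C = ⊕_α H_{a^α} ⊗ H_{ā^α}`. -/
  basis : OrthonormalBasis (Σ α : Fin r, Fin (a α) × Fin (b α)) ℂ C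
  /-- The basis is a Wedderburn basis of `M_A`: `M_A = ⊕_α L(H_{a^α}) ⊗ 1`. -/
  wedderburn : ∀ T : Module.End ℂ C, T ∈ codeAlgebra C A ↔
    ∃ O : ∀ α, Matrix (Fin (a α)) (Fin (a α)) ℂ, ∀ α i j,
      T (basis ⟨α, (i, j)⟩) = ∑ i', O α i' i • basis ⟨α, (i', j)⟩
  UA : EuclideanSpace ℂ (Σ α : Fin r, Fin (a α) × Fin (c α)) →ₗᵢ[ℂ] RegionHilb A G
  UB : EuclideanSpace ℂ (Σ α : Fin r, Fin (b α) × Fin (d α)) →ₗᵢ[ℂ] RegionHilb Aᶜ G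
  /-- The states `|χ_α⟩` on `H_{A₂^α} ⊗ H_{Ā₂^α}`. -/
  χ : ∀ α, EuclideanSpace ℂ (Fin (c α) × Fin (d α))
  norm_χ : ∀ α, ‖χ α‖ = 1
  /-- `|α, i j⟩ = (U_A ⊗ U_Ā) (|α, i⟩ |α, j⟩ |χ_α⟩)`. -/
  basis_eq : ∀ α i j, (basis ⟨α, (i, j)⟩ : Hilb n G) =
    ∑ k, ∑ l, χ α (k, l) •
      prodVec A (UA (EuclideanSpace.single ⟨α, (i, k)⟩ 1))
        (UB (EuclideanSpace.single ⟨α, (j, l)⟩ 1))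

/-- `L` is an area operator of the code for the bipartition `A, Aᶜ`: the code has complementary
recovery and `L = ⊕_α S(χ_α) 1_{a^α ā^α}` for a decomposition as above. -/
def IsAreaOperator (C : Submodule ℂ (Hilb n G)) (A : Finset (Fin n)) (L : Module.End ℂ C) :
    Prop :=
  ∃ D : RecoveryDecomposition C A, ∀ α i j,
    L (D.basis ⟨α, (i, j)⟩) = (entropy (D.χ α) : ℂ) • D.basis ⟨α, (i, j)⟩

end Area

end QCode

set_option linter.unusedSectionVars false

namespace QCode

open Matrix
open scoped Kronecker

/-! ### Wedderburn bases of star-closed operator algebras -/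

section Wedderburn

variable {E : Type*} [NormedAddCommGroup E] [InnerProductSpace ℂ E] [FiniteDimensional ℂ E]

/-! Since `A` is a union of blocks, the unitary `⊗ U_B` factors as `U_A ⊗ U_Ā`
(`exists_tensorOver_eq_loc`). Conjugating the Pauli operators by it gives operators `W v = WA v ⊗ WB
v` that still respect the cut, with the same labels and commutation phases (`WeylSystem.conjugate`).
So the code itself is a stabilizer code for such a `WeylSystem` (`IsStabilizerEncoding`), and the
rest of the argument uses only this structure. Let `S` be its group of stabilizer labels.

Existence. Averaging over conjugations shows that a logical operator commuting with the logical Weyl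
operators of `R^⊥`, where `S ≤ R`, is a combination of those labelled by `R ∩ S^⊥`. Taking `R = S +
Λ_B`, an operator in the commutant of `M_A` only involves labels of the form `s + b`; the stabilizer
part `s` acts as a scalar, so the operator is implemented on `Aᶜ` (`complementary_recovery`). A
Wedderburn basis of `M_A` (`exists_wedderburn_basis`) has matrix units implemented on `A`, and the
matrix units of the commutant are implemented on `Aᶜ`. Applied to one reference vector per sector,
expanded over the supports of its reduced states, they produce the two isometries
(`exists_sector_decomposition`).

Triviality. The code projection is the average of the stabilizer. Its partial trace keeps only the
labels in `S ∩ Λ_A` and is therefore a multiple of a projection (`exists_partialTrace_mul_self`). In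
a sector decomposition the same operator is `⊕ b_α (1 ⊗ ρ_α)` with `ρ_α` the reduced state of `χ_α`,
so `ρ_α² = (λ / b_α) ρ_α`: the spectrum is flat and the entropy is `-log (λ / b_α)`
(`reduced_mul_self`, `entropy_eq_of_mul_self`). Finally `b_α` does not depend on `α`, because
conjugation by logical Weyl operators preserves `M_A` while these operators act irreducibly on the
code (`multiplicity_le`). -/

theorem inner_star_apply (x : Module.End ℂ E) (u v : E) :
    inner ℂ (star x u) v = inner ℂ u (x v) := by
  rw [LinearMap.star_eq_adjoint, LinearMap.adjoint_inner_left]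

theorem eq_zero_of_star_mul_self {x : Module.End ℂ E} (h : star x * x = 0) : x = 0 := by
  ext v
  have : inner ℂ (x v) (x v) = 0 := by
    rw [← inner_star_apply, ← Module.End.mul_apply]
    simp [h]
  simpa using this

/-- A minimal projection of the set `N` of operators. -/
structure IsMinimalProjection (N : Set (Module.End ℂ E)) (e : Module.End ℂ E) : Prop where
  mem : e ∈ N
  ne_zero : e ≠ 0
  mul_self : e * e = e
  star_eq : star e = e
  corner : ∀ y ∈ N, ∃ c : ℂ, e * y * e = c • e

theorem finrank_range_lt_of_ker_lt {f g : Module.End ℂ E} (h : LinearMap.ker f < LinearMap.ker g) :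
    Module.finrank ℂ (LinearMap.range g) < Module.finrank ℂ (LinearMap.range f) := by
  have h1 := LinearMap.finrank_range_add_finrank_ker f
  have h2 := LinearMap.finrank_range_add_finrank_ker g
  have h3 := Submodule.finrank_lt_finrank_of_lt h
  omega

/-- Take `x ≠ 0` in `N` of minimal rank and `h = star x * x`: its kernel contains that of `x`, so a
still larger kernel would mean a smaller rank. -/
theorem exists_selfAdjoint_of_maximal_ker (N : Submodule ℂ (Module.End ℂ E))
    (hmul : ∀ x ∈ N, ∀ y ∈ N, x * y ∈ N) (hstar : ∀ x ∈ N, star x ∈ N) (hN : N ≠ ⊥) :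
    ∃ h ∈ N, h ≠ 0 ∧ star h = h ∧
      ∀ y ∈ N, LinearMap.ker h < LinearMap.ker y → y = 0 := by
  obtain ⟨x, hxN, hx0⟩ := N.ne_bot_iff.1 hN
  obtain ⟨x, ⟨hxN, hx0⟩, hmin⟩ := (InvImage.wf (fun x : Module.End ℂ E =>
    Module.finrank ℂ (LinearMap.range x)) wellFounded_lt).has_min
      {x | x ∈ N ∧ x ≠ 0} ⟨x, hxN, hx0⟩
  refine ⟨star x * x, hmul _ (hstar _ hxN) _ hxN, fun h0 => hx0 (eq_zero_of_star_mul_self h0),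
    by simp, fun y hy hlt => ?_⟩
  by_contra hy0
  refine hmin y ⟨hy, hy0⟩ (finrank_range_lt_of_ker_lt (lt_of_le_of_lt (fun v hv => ?_) hlt))
  rw [LinearMap.mem_ker] at hv ⊢
  rw [Module.End.mul_apply, hv, map_zero]

theorem exists_real_eigenvalue_ne_zero {h : Module.End ℂ E} (hs : star h = h) (h0 : h ≠ 0) :
    ∃ (μ : ℝ) (v : E), μ ≠ 0 ∧ v ≠ 0 ∧ h v = (μ : ℂ) • v := by
  have hsym : h.IsSymmetric := fun u v => by
    rw [← inner_star_apply, hs]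
  by_contra! hcon
  apply h0
  refine (hsym.eigenvectorBasis rfl).toBasis.ext fun i => ?_
  have hi := hsym.apply_eigenvectorBasis rfl i
  have hz : hsym.eigenvalues rfl i = 0 := by
    by_contra hne
    exact hcon _ _ hne ((hsym.eigenvectorBasis rfl).orthonormal.ne_zero i) hi
  rw [OrthonormalBasis.coe_toBasis, hi, hz]
  simp

theorem exists_isMinimalProjection (N : Submodule ℂ (Module.End ℂ E))
    (hmul : ∀ x ∈ N, ∀ y ∈ N, x * y ∈ N) (hstar : ∀ x ∈ N, star x ∈ N) (hN : N ≠ ⊥) :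
    ∃ e, IsMinimalProjection (N : Set (Module.End ℂ E)) e := by
  obtain ⟨h, hhN, hh0, hhs, hzero⟩ := exists_selfAdjoint_of_maximal_ker N hmul hstar hN
  obtain ⟨μ, v, hμ0, hv0, hv⟩ := exists_real_eigenvalue_ne_zero hhs hh0
  have hμ : (μ : ℂ) ≠ 0 := by exact_mod_cast hμ0
  -- The difference lies in `N` and kills `ker h` as well as `v ∉ ker h`, so maximality of the
  -- kernel forces it to vanish.
  have hsq : h * h = (μ : ℂ) • h := by
    rw [← sub_eq_zero]
    refine hzero _ (N.sub_mem (hmul _ hhN _ hhN) (N.smul_mem _ hhN)) ?_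
    refine lt_of_le_of_ne (fun w hw => ?_) fun heq => ?_
    · rw [LinearMap.mem_ker] at hw ⊢
      simp [hw]
    · have : v ∈ LinearMap.ker h := by
        rw [heq, LinearMap.mem_ker, LinearMap.sub_apply, Module.End.mul_apply, hv, map_smul, hv,
          LinearMap.smul_apply, hv, sub_self]
      rw [LinearMap.mem_ker, hv] at this
      exact (smul_ne_zero hμ hv0) this
  have hss : star ((μ : ℂ)⁻¹ • h) = (μ : ℂ)⁻¹ • h := by
    rw [star_smul, hhs]
    simp
  have heN : (μ : ℂ)⁻¹ • h ∈ N := N.smul_mem _ hhN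
  have he : ((μ : ℂ)⁻¹ • h) * ((μ : ℂ)⁻¹ • h) = (μ : ℂ)⁻¹ • h := by
    rw [smul_mul_smul_comm, hsq, smul_smul, mul_assoc, inv_mul_cancel₀ hμ, mul_one]
  have hve : ((μ : ℂ)⁻¹ • h) v = v := by
    rw [LinearMap.smul_apply, hv, smul_smul, inv_mul_cancel₀ hμ, one_smul]
  have hkere : LinearMap.ker ((μ : ℂ)⁻¹ • h) = LinearMap.ker h := by
    ext w
    simp [hμ0]
  refine ⟨(μ : ℂ)⁻¹ • h, heN, smul_ne_zero (inv_ne_zero hμ) hh0, he, hss, ?_⟩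
  rw [← hkere] at hzero
  generalize (μ : ℂ)⁻¹ • h = e at *
  intro y hy
  let W := LinearMap.range e
  have hW : ∀ w ∈ W, e w = w := by
    rintro _ ⟨w, rfl⟩
    rw [← Module.End.mul_apply, he]
  have hmap : ∀ w ∈ W, (e * y) w ∈ W := fun w _ => ⟨y w, rfl⟩
  have : Nontrivial W := ⟨⟨⟨v, v, hve⟩, 0, fun h => hv0 (congrArg Subtype.val h)⟩⟩
  -- The same kernel argument: an eigenvector of the corner inside the range of `e` is killed by `e
  -- * y * e - c • e` but not by `e`.
  obtain ⟨c, hc⟩ := Module.End.exists_eigenvalue ((e * y).restrict hmap)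
  obtain ⟨w, hw⟩ := hc.exists_hasEigenvector
  refine ⟨c, ?_⟩
  rw [← sub_eq_zero]
  refine hzero _ (N.sub_mem (hmul _ (hmul _ heN _ hy) _ heN) (N.smul_mem _ heN)) ?_
  refine lt_of_le_of_ne (fun w hw => ?_) fun heq => ?_
  · rw [LinearMap.mem_ker] at hw ⊢
    simp [hw]
  · have hw1 := congrArg Subtype.val hw.apply_eq_smul
    rw [LinearMap.coe_restrict_apply, Submodule.coe_smul] at hw1
    have : (w : E) ∈ LinearMap.ker e := by
      rw [heq, LinearMap.mem_ker, LinearMap.sub_apply, Module.End.mul_apply, LinearMap.smul_apply,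
        hW _ w.2, hw1, sub_self]
    rw [LinearMap.mem_ker, hW _ w.2] at this
    exact hw.2 (Subtype.ext this)

/-- An orthonormal basis of the left ideal generated by a minimal projection. -/
theorem IsMinimalProjection.exists_partial_isometries {M : Submodule ℂ (Module.End ℂ E)}
    (hmul : ∀ x ∈ M, ∀ y ∈ M, x * y ∈ M) (hstar : ∀ x ∈ M, star x ∈ M) {e : Module.End ℂ E}
    (he : IsMinimalProjection (M : Set (Module.End ℂ E)) e) :
    ∃ (a : ℕ) (w : Fin a → Module.End ℂ E), 0 < a ∧ (∀ i, w i ∈ M) ∧ (∀ i, w i * e = w i) ∧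
      (∀ i j, star (w i) * w j = if i = j then e else 0) ∧
      ∀ x ∈ M, ∃ c : Fin a → ℂ, x * e = ∑ i, c i • w i := by
  obtain ⟨f, hf⟩ : ∃ f, ‖f‖ = 1 ∧ e f = f := by
    obtain ⟨v, hv⟩ : ∃ v, e v ≠ 0 := by
      by_contra! h
      exact he.ne_zero (LinearMap.ext h)
    refine ⟨((‖e v‖⁻¹ : ℝ) : ℂ) • e v, ?_, ?_⟩
    · simp [norm_smul, hv]
    · rw [map_smul, ← Module.End.mul_apply, he.mul_self]
  have hff : inner ℂ f f = (1 : ℂ) := by simp [inner_self_eq_norm_sq_to_K, hf.1]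
  let I : Submodule ℂ (Module.End ℂ E) := M ⊓ LinearMap.eqLocus (LinearMap.mulRight ℂ e) LinearMap.id
  have hI : ∀ x, x ∈ I ↔ x ∈ M ∧ x * e = x := fun x => by simp [I, LinearMap.mem_eqLocus]
  -- By minimality of `e`, evaluation at the unit vector `f` identifies the operator-valued Gram
  -- form on the left ideal with an ordinary inner product, so orthonormal vectors lift to partial
  -- isometries.
  have hgram : ∀ x ∈ I, ∀ y ∈ I, star x * y = (inner ℂ (x f) (y f) : ℂ) • e := by
    intro x hx y hy
    rw [hI] at hx hy
    obtain ⟨c, hc⟩ := he.corner _ (hmul _ (hstar _ hx.1) _ hy.1)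
    have h1 : star x * y = c • e := by
      have hex : e * star x = star x := by
        rw [← he.star_eq, ← star_mul, hx.2]
      rw [← hc, ← mul_assoc e, mul_assoc, hy.2, hex]
    rw [h1]
    congr 1
    rw [← star_star x, inner_star_apply, ← Module.End.mul_apply, h1]
    simp [hf.1, hf.2]
  let W : Submodule ℂ E := I.map (LinearMap.applyₗ f)
  let b := stdOrthonormalBasis ℂ W
  have hb : ∀ i, ∃ w ∈ I, w f = (b i : E) := fun i => by
    obtain ⟨w, hw, hwf⟩ := (b i).2
    exact ⟨w, hw, hwf⟩
  choose w hwI hwf using hb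
  have hfW : f ∈ W := ⟨e, (hI e).2 ⟨he.mem, he.mul_self⟩, hf.2⟩
  refine ⟨_, w, ?_, fun i => ((hI _).1 (hwI i)).1, fun i => ((hI _).1 (hwI i)).2, ?_, ?_⟩
  · have : Nontrivial W := ⟨⟨⟨f, hfW⟩, 0, fun h => by
      have : f = 0 := congrArg Subtype.val h
      simp [this] at hf⟩⟩
    exact Module.finrank_pos
  · intro i j
    rw [hgram _ (hwI i) _ (hwI j), hwf, hwf, ← Submodule.coe_inner,
      orthonormal_iff_ite.1 b.orthonormal i j]
    split_ifs <;> simp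
  · intro x hx
    have hxI : x * e ∈ I := (hI _).2 ⟨hmul _ hx _ he.mem, by rw [mul_assoc, he.mul_self]⟩
    let u : W := ⟨(x * e) f, x * e, hxI, rfl⟩
    refine ⟨fun i => b.repr u i, ?_⟩
    rw [← sub_eq_zero]
    have hyI : x * e - ∑ i, b.repr u i • w i ∈ I :=
      I.sub_mem hxI (I.sum_mem fun i _ => I.smul_mem _ (hwI i))
    apply eq_zero_of_star_mul_self
    have hyf : (x * e - ∑ i, b.repr u i • w i) f = 0 := by
      have := congrArg Subtype.val (b.sum_repr u)
      simp only [Submodule.coe_sum, Submodule.coe_smul] at this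
      simp only [LinearMap.sub_apply, LinearMap.sum_apply, LinearMap.smul_apply, hwf, this, u,
        sub_self]
    rw [hgram _ hyI _ hyI, hyf]
    simp

/-- Multiplying a linear relation by one member isolates its coefficient, so the family is linearly
independent. -/
theorem finite_of_pairwise_mul_eq_zero {F : Set (Module.End ℂ E)}
    (h0 : ∀ e ∈ F, e ≠ 0) (hF : ∀ e ∈ F, e * e = e) (h : F.Pairwise fun e f => e * f = 0) :
    F.Finite := by
  have : LinearIndependent ℂ (fun e : F => (e : Module.End ℂ E)) := by
    rw [linearIndependent_iff']
    intro s g hs i hi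
    have h1 := congrArg (fun y => (i : Module.End ℂ E) * y) hs
    simp only [Finset.mul_sum, mul_zero] at h1
    rw [Finset.sum_eq_single_of_mem i hi, mul_smul_comm, hF _ i.2] at h1
    · exact (smul_eq_zero.1 h1).resolve_right (h0 _ i.2)
    · intro j _ hji
      rw [mul_smul_comm, h i.2 j.2 (fun h => hji (Subtype.ext h.symm)), smul_zero]
  exact this.setFinite

/-- Zorn's lemma. In a star-closed algebra, `e * x * f = 0` for all `x` separates minimal
projections of different simple blocks, so a maximal family represents every block once. -/
theorem exists_maximal_minimalProjections (M : Submodule ℂ (Module.End ℂ E)) (hone : 1 ∈ M) :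
    ∃ F : Set (Module.End ℂ E), F.Finite ∧
      (∀ e ∈ F, IsMinimalProjection (M : Set (Module.End ℂ E)) e) ∧
      (F.Pairwise fun e f => ∀ x ∈ M, e * x * f = 0) ∧
      ∀ e, IsMinimalProjection (M : Set (Module.End ℂ E)) e →
        (∀ f ∈ F, ∀ x ∈ M, e * x * f = 0 ∧ f * x * e = 0) → False := by
  let S : Set (Set (Module.End ℂ E)) := {F | (∀ e ∈ F, IsMinimalProjection (M : Set _) e) ∧
    F.Pairwise fun e f => ∀ x ∈ M, e * x * f = 0}
  obtain ⟨F, hF⟩ := zorn_subset S fun c hcS hc => by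
    refine ⟨⋃₀ c, ⟨?_, ?_⟩, fun s hs => Set.subset_sUnion_of_mem hs⟩
    · rintro e ⟨s, hs, he⟩
      exact (hcS hs).1 e he
    · exact (Set.pairwise_sUnion hc.directedOn).2 fun s hs => (hcS hs).2
  refine ⟨F, ?_, hF.prop.1, hF.prop.2, fun e he hann => ?_⟩
  · refine finite_of_pairwise_mul_eq_zero (fun e he => (hF.prop.1 e he).ne_zero)
      (fun e he => (hF.prop.1 e he).mul_self) fun e he f hf hne => ?_
    simpa using hF.prop.2 he hf hne 1 hone
  · have hins : insert e F ∈ S := by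
      refine ⟨?_, ?_⟩
      · rintro f (rfl | hf)
        · exact he
        · exact hF.prop.1 f hf
      · refine hF.prop.2.insert fun f hf _ => ⟨fun x hx => (hann f hf x hx).1,
          fun x hx => (hann f hf x hx).2⟩
    have heF : e ∈ F := hF.le_of_ge hins (Set.subset_insert e F) (Set.mem_insert e F)
    have := (hann e heF 1 hone).1
    rw [mul_one, he.mul_self] at this
    exact he.ne_zero this

theorem exists_unitary_frame {e : Module.End ℂ E} (he : e * e = e) :
    ∃ (f : Fin (Module.finrank ℂ (LinearMap.range e)) → E), Orthonormal ℂ f ∧ (∀ j, e (f j) = f j) ∧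
      ∀ v, ∃ c : Fin (Module.finrank ℂ (LinearMap.range e)) → ℂ, e v = ∑ j, c j • f j := by
  let b := stdOrthonormalBasis ℂ (LinearMap.range e)
  refine ⟨fun j => b j, b.orthonormal.comp_linearIsometry (LinearMap.range e).subtypeₗᵢ,
    fun j => ?_, fun v => ?_⟩
  · obtain ⟨v, hv⟩ := (b j).2
    change e (b j) = b j
    rw [← hv, ← Module.End.mul_apply, he]
  · let u : LinearMap.range e := ⟨e v, v, rfl⟩
    refine ⟨fun j => b.repr u j, ?_⟩
    have := congrArg Subtype.val (b.sum_repr u)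
    simp only [Submodule.coe_sum, Submodule.coe_smul] at this
    exact this.symm

/-- A unital star-closed algebra of operators on a finite-dimensional Hilbert space has a
Wedderburn basis. -/
theorem exists_wedderburn_basis (M : Submodule ℂ (Module.End ℂ E)) (hone : 1 ∈ M)
    (hmul : ∀ x ∈ M, ∀ y ∈ M, x * y ∈ M) (hstar : ∀ x ∈ M, star x ∈ M) :
    ∃ (r : ℕ) (a b : Fin r → ℕ)
      (B : OrthonormalBasis (Σ α : Fin r, Fin (a α) × Fin (b α)) ℂ E),
      (∀ α, 0 < a α) ∧ (∀ α, 0 < b α) ∧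
      ∀ T : Module.End ℂ E, T ∈ M ↔ ∃ O : ∀ α, Matrix (Fin (a α)) (Fin (a α)) ℂ, ∀ α i j,
        T (B ⟨α, (i, j)⟩) = ∑ i', O α i' i • B ⟨α, (i', j)⟩ := by
  classical
  obtain ⟨F, hFfin, hmin, hpair, hmax⟩ := exists_maximal_minimalProjections M hone
  have := hFfin.fintype
  let eqv := (Fintype.equivFin F).symm
  let e : Fin (Fintype.card F) → Module.End ℂ E := fun α => eqv α
  have he : ∀ α, IsMinimalProjection (M : Set (Module.End ℂ E)) (e α) := fun α => hmin _ (eqv α).2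
  have horth : ∀ α β, α ≠ β → ∀ x ∈ M, e α * x * e β = 0 := fun α β hne =>
    hpair (eqv α).2 (eqv β).2 fun h => hne (eqv.injective (Subtype.ext h))
  have hmax' : ∀ e', IsMinimalProjection (M : Set (Module.End ℂ E)) e' →
      (∀ α, ∀ x ∈ M, e' * x * e α = 0 ∧ e α * x * e' = 0) → False := fun e' he' h =>
    hmax e' he' fun f hf x hx => by
      have := h (eqv.symm ⟨f, hf⟩) x hx
      simpa [e] using this
  choose a w ha hwM hwe hww hspan using fun α => (he α).exists_partial_isometries hmul hstar
  choose f hfon hef hfspan using fun α => exists_unitary_frame (he α).mul_self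
  have hsw : ∀ α i, e α * star (w α i) = star (w α i) := fun α i => by
    rw [← (he α).star_eq, ← star_mul, hwe]
  have hcross : ∀ α β, α ≠ β → ∀ i j, star (w α i) * w β j = 0 := fun α β hne i j => by
    rw [← hsw, ← hwe β j, ← mul_assoc, mul_assoc (e α)]
    exact horth α β hne _ (hmul _ (hstar _ (hwM α i)) _ (hwM β j))
  set p : Module.End ℂ E := ∑ α, ∑ i, w α i * star (w α i) with hp
  have hpM : p ∈ M := M.sum_mem fun α _ => M.sum_mem fun i _ => hmul _ (hwM α i) _ (hstar _ (hwM α i))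
  have hps : star p = p := by simp [hp, star_sum]
  have hpw : ∀ α i, p * w α i = w α i := by
    intro α i
    rw [hp, Finset.sum_mul, Finset.sum_eq_single α, Finset.sum_mul, Finset.sum_eq_single i]
    · rw [mul_assoc, hww, if_pos rfl, hwe]
    · intro j _ hj
      rw [mul_assoc, hww, if_neg hj, mul_zero]
    · simp
    · intro β _ hβ
      rw [Finset.sum_mul]
      exact Finset.sum_eq_zero fun j _ => by rw [mul_assoc, hcross β α hβ, mul_zero]
    · simp
  have hpxe : ∀ x ∈ M, ∀ α, p * (x * e α) = x * e α := by
    intro x hx α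
    obtain ⟨c, hc⟩ := hspan α x hx
    rw [hc, Finset.mul_sum]
    exact Finset.sum_congr rfl fun i _ => by rw [mul_smul_comm, hpw]
  have hpp : p * p = p := by
    nth_rewrite 2 3 [hp]
    simp only [Finset.mul_sum, ← mul_assoc, hpw]
  -- Otherwise the corner cut out by `1 - p` contains a minimal projection `e'`. It is minimal in
  -- `M` too, and it annihilates each `x * e α`, which lies under `p`; this contradicts maximality.
  have hp1 : p = 1 := by
    by_contra hne
    let N : Submodule ℂ (Module.End ℂ E) := M ⊓ (LinearMap.ker (LinearMap.mulLeft ℂ p) ⊓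
      LinearMap.ker (LinearMap.mulRight ℂ p))
    have hN : ∀ x, x ∈ N ↔ x ∈ M ∧ p * x = 0 ∧ x * p = 0 := fun x => by
      simp [N, Submodule.mem_inf, LinearMap.mem_ker]
    obtain ⟨e', he'⟩ := exists_isMinimalProjection N
      (fun x hx y hy => by
        rw [hN] at *
        exact ⟨hmul _ hx.1 _ hy.1, by rw [← mul_assoc, hx.2.1, zero_mul],
          by rw [mul_assoc, hy.2.2, mul_zero]⟩)
      (fun x hx => by
        rw [hN] at *
        refine ⟨hstar _ hx.1, ?_, ?_⟩
        · rw [← hps, ← star_mul, hx.2.2, star_zero]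
        · rw [← hps, ← star_mul, hx.2.1, star_zero])
      (N.ne_bot_iff.2 ⟨1 - p, (hN _).2 ⟨M.sub_mem hone hpM, by simp [mul_sub, hpp],
        by simp [sub_mul, hpp]⟩, sub_ne_zero.2 (Ne.symm hne)⟩)
    have he'N := (hN _).1 he'.mem
    have hann : ∀ α, ∀ x ∈ M, e' * x * e α = 0 := fun α x hx => by
      rw [mul_assoc, ← hpxe x hx, ← mul_assoc, he'N.2.2, zero_mul]
    refine hmax' e' ⟨he'N.1, he'.ne_zero, he'.mul_self, he'.star_eq, fun y hy => ?_⟩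
      fun α x hx => ⟨hann α x hx, ?_⟩
    · obtain ⟨c, hc⟩ := he'.corner ((1 - p) * y * (1 - p)) ((hN _).2 ⟨hmul _ (hmul _ (M.sub_mem hone hpM) _ hy)
        _ (M.sub_mem hone hpM), by simp [← mul_assoc, mul_sub, hpp],
        by simp [mul_assoc, sub_mul, hpp]⟩)
      refine ⟨c, ?_⟩
      have h1 : e' * (1 - p) = e' := by rw [mul_sub, he'N.2.2, mul_one, sub_zero]
      have h2 : (1 - p) * e' = e' := by rw [sub_mul, he'N.2.1, one_mul, sub_zero]
      calc e' * y * e' = (e' * (1 - p)) * y * ((1 - p) * e') := by rw [h1, h2]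
        _ = e' * ((1 - p) * y * (1 - p)) * e' := by simp only [mul_assoc]
        _ = c • e' := hc
    · have := congrArg star (hann α (star x) (hstar x hx))
      simpa [(he α).star_eq, he'.star_eq, mul_assoc] using this
  let B : (Σ α, Fin (a α) × Fin (Module.finrank ℂ (LinearMap.range (e α)))) → E :=
    fun k => w k.1 k.2.1 (f k.1 k.2.2)
  have hwB : ∀ α i β i' j, star (w α i) (w β i' (f β j)) =
      if α = β ∧ HEq i i' then f β j else 0 := by
    intro α i β i' j
    rw [← Module.End.mul_apply]
    by_cases hαβ : α = β
    · subst hαβ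
      by_cases hi : i = i'
      · simp [hww, hi, hef]
      · simp [hww, hi]
    · simp [hcross α β hαβ, hαβ]
  have hBon : Orthonormal ℂ B := by
    rw [orthonormal_iff_ite]
    rintro ⟨α, i, j⟩ ⟨β, i', j'⟩
    simp only [B]
    rw [← star_star (w α i), inner_star_apply, hwB]
    by_cases hαβ : α = β
    · subst hαβ
      by_cases hi : i = i'
      · simp [hi, orthonormal_iff_ite.1 (hfon α) j j']
      · simp [hi]
    · simp [hαβ]
  have hBspan : ⊤ ≤ Submodule.span ℂ (Set.range B) := by
    intro v _
    have hv : v = ∑ α, ∑ i, w α i (star (w α i) v) := by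
      conv_lhs => rw [← Module.End.one_apply (R := ℂ) v, ← hp1, hp]
      simp
    rw [hv]
    refine Submodule.sum_mem _ fun α _ => Submodule.sum_mem _ fun i _ => ?_
    obtain ⟨c, hc⟩ := hfspan α (star (w α i) v)
    rw [← Module.End.mul_apply, hsw] at hc
    rw [hc, map_sum]
    refine Submodule.sum_mem _ fun j _ => ?_
    rw [map_smul]
    exact Submodule.smul_mem _ _ (Submodule.subset_span ⟨⟨α, i, j⟩, rfl⟩)
  let BB := OrthonormalBasis.mk hBon hBspan
  have hBB : ∀ α i j, BB ⟨α, (i, j)⟩ = w α i (f α j) := fun α i j => by simp [BB, B]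
  refine ⟨_, a, _, BB, ha, fun α => ?_, fun T => ⟨fun hT => ?_, ?_⟩⟩
  · rw [Module.finrank_pos_iff_exists_ne_zero]
    obtain ⟨v, hv⟩ : ∃ v, e α v ≠ 0 := by
      by_contra! h
      exact (he α).ne_zero (LinearMap.ext h)
    exact ⟨⟨e α v, v, rfl⟩, fun h => hv (congrArg Subtype.val h)⟩
  · choose c hc using fun α i => hspan α (T * w α i) (hmul _ hT _ (hwM α i))
    refine ⟨fun α i' i => c α i i', fun α i j => ?_⟩
    have := hc α i
    rw [mul_assoc, hwe] at this
    rw [hBB, ← Module.End.mul_apply, this]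
    simp [hBB]
  · rintro ⟨O, hO⟩
    have hTeq : T = ∑ α, ∑ i, ∑ i', O α i' i • (w α i' * star (w α i)) := by
      refine BB.toBasis.ext ?_
      rintro ⟨β, i, j⟩
      rw [OrthonormalBasis.coe_toBasis, hO]
      simp only [hBB, LinearMap.sum_apply, LinearMap.smul_apply, Module.End.mul_apply, hwB]
      rw [eq_comm, Finset.sum_eq_single β, Finset.sum_eq_single i]
      · simp
      · intro i' _ hi'
        simp [hi']
      · simp
      · intro α _ hα
        simp [hα]
      · simp
    rw [hTeq]
    exact M.sum_mem fun α _ => M.sum_mem fun i _ => M.sum_mem fun i' _ =>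
      M.smul_mem _ (hmul _ (hwM α i') _ (hstar _ (hwM α i)))

end Wedderburn

/-! ### Operators and vectors across the cut `A`, `Aᶜ` -/

section Region

variable {n : ℕ} {G : Type*}

/-- A basis label of `n` qudits as a pair of labels on a region and on its complement. -/
def splitEquiv (A : Finset (Fin n)) (G : Type*) : (Fin n → G) ≃ (A → G) × (↥Aᶜ → G) where
  toFun x := (res A x, res Aᶜ x)
  invFun p i := if h : i ∈ A then p.1 ⟨i, h⟩ else p.2 ⟨i, Finset.mem_compl.2 h⟩
  left_inv x := by
    ext i
    simp [res]
  right_inv p := by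
    ext i
    · simp [res]
    · have := Finset.mem_compl.1 i.2
      simp [res, this]

@[simp] theorem splitEquiv_apply (A : Finset (Fin n)) (x : Fin n → G) :
    splitEquiv A G x = (res A x, res Aᶜ x) := rfl

theorem res_compl_compl_eq_iff (A : Finset (Fin n)) (x y : Fin n → G) :
    res Aᶜᶜ x = res Aᶜᶜ y ↔ res A x = res A y := by
  simp only [funext_iff, res, Subtype.forall, compl_compl]

variable [Fintype G] [DecidableEq G]

/-- The operator `O ⊗ Q` on `H = H_A ⊗ H_{Aᶜ}`. -/
def loc (A : Finset (Fin n)) (O : Matrix (A → G) (A → G) ℂ) (Q : Matrix (↥Aᶜ → G) (↥Aᶜ → G) ℂ) :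
    Matrix (Fin n → G) (Fin n → G) ℂ :=
  (O ⊗ₖ Q).submatrix (splitEquiv A G) (splitEquiv A G)

variable (A : Finset (Fin n)) (O O' : Matrix (A → G) (A → G) ℂ)
  (Q Q' : Matrix (↥Aᶜ → G) (↥Aᶜ → G) ℂ)

theorem loc_apply (x y : Fin n → G) :
    loc A O Q x y = O (res A x) (res A y) * Q (res Aᶜ x) (res Aᶜ y) := rfl

theorem onRegion_eq_loc : onRegion A O = loc A O 1 := by
  ext x y
  simp [onRegion, loc_apply, Matrix.one_apply]

theorem onRegion_compl_eq_loc : onRegion Aᶜ Q = loc A 1 Q := by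
  ext x y
  simp [onRegion, loc_apply, Matrix.one_apply, res_compl_compl_eq_iff]

theorem loc_mul_loc : loc A O Q * loc A O' Q' = loc A (O * O') (Q * Q') := by
  rw [loc, loc, Matrix.submatrix_mul_equiv, ← Matrix.mul_kronecker_mul]
  rfl

theorem loc_conjTranspose : (loc A O Q)ᴴ = loc A Oᴴ Qᴴ := by
  ext x y
  simp [loc_apply, Matrix.conjTranspose_apply]

theorem loc_one_one : loc A (1 : Matrix (A → G) (A → G) ℂ) 1 = 1 := by
  rw [loc, Matrix.one_kronecker_one, Matrix.submatrix_one_equiv]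

theorem loc_smul_left (c : ℂ) : loc A (c • O) Q = c • loc A O Q := by
  ext x y
  simp [loc_apply, mul_assoc]

theorem onRegion_add : onRegion A (O + O') = onRegion A O + onRegion A O' := by
  ext x y
  simp only [onRegion, Matrix.of_apply, Matrix.add_apply]
  split_ifs <;> simp

theorem onRegion_smul (c : ℂ) : onRegion A (c • O) = c • onRegion A O := by
  rw [onRegion_eq_loc, loc_smul_left, onRegion_eq_loc]

theorem onRegion_zero : onRegion A (0 : Matrix (A → G) (A → G) ℂ) = 0 := by
  ext x y
  simp [onRegion]

theorem onRegion_sum {ι : Type*} (s : Finset ι) (f : ι → Matrix (A → G) (A → G) ℂ) :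
    onRegion A (∑ i ∈ s, f i) = ∑ i ∈ s, onRegion A (f i) := by
  classical
  induction s using Finset.induction_on with
  | empty => simp [onRegion_zero]
  | insert i s hi ih => rw [Finset.sum_insert hi, Finset.sum_insert hi, onRegion_add, ih]

theorem onRegion_mul : onRegion A (O * O') = onRegion A O * onRegion A O' := by
  simp [onRegion_eq_loc, loc_mul_loc]

theorem onRegion_one : onRegion A (1 : Matrix (A → G) (A → G) ℂ) = 1 := by
  rw [onRegion_eq_loc, loc_one_one]

theorem onRegion_conjTranspose : onRegion A Oᴴ = (onRegion A O)ᴴ := by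
  simp [onRegion_eq_loc, loc_conjTranspose]

theorem onRegion_mul_onRegion_compl : onRegion A O * onRegion Aᶜ Q = loc A O Q := by
  rw [onRegion_compl_eq_loc, onRegion_eq_loc, loc_mul_loc, Matrix.mul_one, Matrix.one_mul]

theorem onRegion_injective [Nonempty G] :
    Function.Injective (onRegion A : Matrix (A → G) (A → G) ℂ → _) := by
  intro O O' h
  ext a b
  obtain ⟨g⟩ := ‹Nonempty G›
  let z : ↥Aᶜ → G := fun _ => g
  have h1 := congrFun (congrFun h ((splitEquiv A G).symm (a, z))) ((splitEquiv A G).symm (b, z))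
  have h2 : ∀ a, res A ((splitEquiv A G).symm (a, z)) = a := fun a =>
    congrArg Prod.fst ((splitEquiv A G).apply_symm_apply (a, z))
  have h3 : ∀ a, res Aᶜ ((splitEquiv A G).symm (a, z)) = z := fun a =>
    congrArg Prod.snd ((splitEquiv A G).apply_symm_apply (a, z))
  simpa [onRegion, h2, h3] using h1

/-- The coefficient matrix of a vector of `H = H_A ⊗ H_{Aᶜ}`. -/
def coeffMatrix : Hilb n G ≃ₗ[ℂ] Matrix (A → G) (↥Aᶜ → G) ℂ where
  toFun ψ := Matrix.of fun a b => ψ ((splitEquiv A G).symm (a, b))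
  invFun X := WithLp.toLp 2 fun x => X (res A x) (res Aᶜ x)
  map_add' _ _ := rfl
  map_smul' _ _ := rfl
  left_inv ψ := by
    ext x
    simp [← splitEquiv_apply]
  right_inv X := by
    ext a b
    have := (splitEquiv A G).apply_symm_apply (a, b)
    rw [splitEquiv_apply, Prod.mk.injEq] at this
    simp [this]

theorem coeffMatrix_symm_apply (X : Matrix (A → G) (↥Aᶜ → G) ℂ) (x : Fin n → G) :
    (coeffMatrix A).symm X x = X (res A x) (res Aᶜ x) := rfl

theorem coeffMatrix_res (ψ : Hilb n G) (x : Fin n → G) :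
    coeffMatrix A ψ (res A x) (res Aᶜ x) = ψ x := by
  exact congrArg (fun φ : Hilb n G => φ x) ((coeffMatrix A).symm_apply_apply ψ)

theorem coeffMatrix_prodVec (φ : RegionHilb A G) (η : RegionHilb Aᶜ G) :
    coeffMatrix A (prodVec A φ η) = Matrix.vecMulVec φ η := by
  rw [← LinearEquiv.eq_symm_apply]
  rfl

theorem coeffMatrix_loc (ψ : Hilb n G) :
    coeffMatrix A (toEuclideanLin (loc A O Q) ψ) = O * coeffMatrix A ψ * Qᵀ := by
  rw [← LinearEquiv.eq_symm_apply]
  ext x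
  rw [coeffMatrix_symm_apply, toLpLin_apply, WithLp.ofLp_toLp, Matrix.mulVec, dotProduct]
  simp only [Matrix.mul_apply, Finset.sum_mul, Matrix.transpose_apply]
  rw [Finset.sum_comm, ← Fintype.sum_prod_type']
  refine Fintype.sum_equiv (splitEquiv A G) _ _ fun y => ?_
  rw [loc_apply, splitEquiv_apply, coeffMatrix_res]
  ring

theorem loc_prodVec (φ : RegionHilb A G) (η : RegionHilb Aᶜ G) :
    toEuclideanLin (loc A O Q) (prodVec A φ η) =
      prodVec A (toEuclideanLin O φ) (toEuclideanLin Q η) := by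
  apply (coeffMatrix A).injective
  rw [coeffMatrix_loc, coeffMatrix_prodVec, coeffMatrix_prodVec, Matrix.mul_vecMulVec,
    Matrix.vecMulVec_mul, Matrix.vecMul_transpose]
  rfl

theorem inner_prodVec (φ φ' : RegionHilb A G) (η η' : RegionHilb Aᶜ G) :
    inner ℂ (prodVec A φ η) (prodVec A φ' η') = (inner ℂ φ φ' * inner ℂ η η' : ℂ) := by
  simp only [PiLp.inner_apply, Finset.sum_mul_sum, ← Fintype.sum_prod_type']
  refine Fintype.sum_equiv (splitEquiv A G) _ _ fun x => ?_
  simp [prodVec]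
  ring

end Region

/-! ### Expansion over the supports of the reduced states -/

section Schmidt

variable {m k : Type*} [Fintype m] [Fintype k] [DecidableEq m] [DecidableEq k]

/-- The columns of `U` form an orthonormal basis of the column space of `X`. The factorisation `U =
X * Y` is recorded because it carries `O * X = s • X` over to `O * U = s • U`. -/
theorem exists_isometry_range (X : Matrix m k ℂ) :
    ∃ (c : ℕ) (U : Matrix m (Fin c) ℂ) (Y : Matrix k (Fin c) ℂ),
      Uᴴ * U = 1 ∧ U = X * Y ∧ U * Uᴴ * X = X := by
  let R := LinearMap.range (toEuclideanLin X)
  let b := stdOrthonormalBasis ℂ R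
  choose y hy using fun i => (b i).2
  refine ⟨_, Matrix.of fun i l => (b l : EuclideanSpace ℂ m) i, Matrix.of fun j l => y l j,
    ?_, ?_, ?_⟩
  · ext l l'
    have := orthonormal_iff_ite.1 b.orthonormal l l'
    rw [Submodule.coe_inner, PiLp.inner_apply] at this
    rw [Matrix.one_apply, ← this, Matrix.mul_apply]
    simp [mul_comm]
  · ext i l
    rw [Matrix.of_apply, ← hy l]
    rfl
  · ext i j
    let u : R := ⟨toEuclideanLin X (EuclideanSpace.single j 1), _, rfl⟩
    have hu : ∀ i, (u : EuclideanSpace ℂ m) i = X i j := fun i => by simp [u, toLpLin_apply]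
    have h1 := congrArg (fun v : R => (v : EuclideanSpace ℂ m) i) (b.sum_repr u)
    simp only [hu, Submodule.coe_sum, Submodule.coe_smul, WithLp.ofLp_sum, Finset.sum_apply,
      WithLp.ofLp_smul, Pi.smul_apply, smul_eq_mul, b.repr_apply_apply, Submodule.coe_inner,
      PiLp.inner_apply] at h1
    rw [← h1, Matrix.mul_assoc, Matrix.mul_apply]
    refine Finset.sum_congr rfl fun l _ => ?_
    rw [Matrix.mul_apply, mul_comm]
    simp [mul_comm]

theorem orthonormal_columns {c : ℕ} {U : Matrix m (Fin c) ℂ} (hU : Uᴴ * U = 1) :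
    Orthonormal ℂ fun l => (WithLp.toLp 2 fun i => U i l : EuclideanSpace ℂ m) := by
  rw [orthonormal_iff_ite]
  intro l l'
  rw [← Matrix.one_apply, ← hU, PiLp.inner_apply, Matrix.mul_apply]
  simp [mul_comm]

variable {n : ℕ} {G : Type*} [Fintype G] [DecidableEq G]

/-- A vector of `H_A ⊗ H_{Aᶜ}`, expanded in orthonormal bases of the supports of its reduced
states. -/
theorem exists_support_expansion (A : Finset (Fin n)) (ψ : Hilb n G) :
    ∃ (c d : ℕ) (u : Fin c → RegionHilb A G) (v : Fin d → RegionHilb Aᶜ G)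
      (χ : EuclideanSpace ℂ (Fin c × Fin d)),
      Orthonormal ℂ u ∧ Orthonormal ℂ v ∧ ‖χ‖ = ‖ψ‖ ∧
      ψ = ∑ k, ∑ l, χ (k, l) • prodVec A (u k) (v l) ∧
      (∀ (O : Matrix (A → G) (A → G) ℂ) (s : ℂ), toEuclideanLin (onRegion A O) ψ = s • ψ →
        ∀ k, toEuclideanLin O (u k) = s • u k) ∧
      (∀ (Q : Matrix (↥Aᶜ → G) (↥Aᶜ → G) ℂ) (s : ℂ), toEuclideanLin (onRegion Aᶜ Q) ψ = s • ψ →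
        ∀ l, toEuclideanLin Q (v l) = s • v l) := by
  set X := coeffMatrix A ψ with hX
  obtain ⟨c, U, Y, hUU, hUY, hUX⟩ := exists_isometry_range X
  obtain ⟨d, V, Z, hVV, hVZ, hVX⟩ := exists_isometry_range Xᵀ
  let u : Fin c → RegionHilb A G := fun k => WithLp.toLp 2 fun i => U i k
  let v : Fin d → RegionHilb Aᶜ G := fun l => WithLp.toLp 2 fun i => V i l
  -- `V` spans the column space of `Xᵀ`, not of `Xᴴ`, since `φ ⊗ η` has coefficient matrix `φ ηᵀ`;
  -- hence the entrywise conjugate `Vᴴᵀ`.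
  let χ : EuclideanSpace ℂ (Fin c × Fin d) := WithLp.toLp 2 fun p => (Uᴴ * X * Vᴴᵀ) p.1 p.2
  have hu : Orthonormal ℂ u := orthonormal_columns hUU
  have hv : Orthonormal ℂ v := orthonormal_columns hVV
  have hψ : ψ = ∑ k, ∑ l, χ (k, l) • prodVec A (u k) (v l) := by
    apply (coeffMatrix A).injective
    have h1 : X = U * (Uᴴ * X * Vᴴᵀ) * Vᵀ := by
      have h2 := congrArg Matrix.transpose hVX
      rw [Matrix.transpose_mul, Matrix.transpose_mul, Matrix.transpose_transpose] at h2
      calc X = X * (Vᴴᵀ * Vᵀ) := h2.symm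
        _ = (U * Uᴴ * X) * (Vᴴᵀ * Vᵀ) := by rw [hUX]
        _ = _ := by simp only [Matrix.mul_assoc]
    rw [← hX, h1]
    ext a b
    simp only [map_sum, map_smul, coeffMatrix_prodVec, Matrix.sum_apply, Matrix.smul_apply,
      Matrix.vecMulVec_apply, smul_eq_mul]
    rw [Matrix.mul_apply, Finset.sum_comm]
    refine Finset.sum_congr rfl fun l _ => ?_
    rw [Matrix.mul_apply, Finset.sum_mul]
    refine Finset.sum_congr rfl fun k _ => ?_
    simp only [χ, u, v, Matrix.transpose_apply]
    ring
  refine ⟨c, d, u, v, χ, hu, hv, ?_, hψ, fun O s h k => ?_, fun Q s h l => ?_⟩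
  · have hw : Orthonormal ℂ fun p : Fin c × Fin d => prodVec A (u p.1) (v p.2) := by
      rw [orthonormal_iff_ite]
      rintro ⟨k, l⟩ ⟨k', l'⟩
      rw [inner_prodVec, orthonormal_iff_ite.1 hu, orthonormal_iff_ite.1 hv]
      by_cases hk : k = k' <;> by_cases hl : l = l' <;> simp [hk, hl]
    have h1 : inner ℂ ψ ψ = (inner ℂ χ χ : ℂ) := by
      have h2 : ψ = ∑ p : Fin c × Fin d, χ p • prodVec A (u p.1) (v p.2) := by
        rw [Fintype.sum_prod_type]
        exact hψ
      rw [h2, hw.inner_sum, PiLp.inner_apply]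
      exact Finset.sum_congr rfl fun p _ => mul_comm _ _
    rw [inner_self_eq_norm_sq_to_K, inner_self_eq_norm_sq_to_K] at h1
    have h3 : ‖ψ‖ ^ 2 = ‖χ‖ ^ 2 := by exact_mod_cast h1
    exact ((sq_eq_sq₀ (norm_nonneg _) (norm_nonneg _)).1 h3).symm
  · have h1 : O * U = s • U := by
      have h2 := congrArg (coeffMatrix A) h
      rw [onRegion_eq_loc, coeffMatrix_loc, map_smul, Matrix.transpose_one, Matrix.mul_one] at h2
      rw [hUY, ← Matrix.mul_assoc, h2, Matrix.smul_mul]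
    ext a
    exact congrFun (congrFun h1 a) k
  · have h1 : Q * V = s • V := by
      have h2 := congrArg (coeffMatrix A) h
      rw [onRegion_compl_eq_loc, coeffMatrix_loc, map_smul, Matrix.one_mul] at h2
      have h3 := congrArg Matrix.transpose h2
      rw [Matrix.transpose_mul, Matrix.transpose_transpose, Matrix.transpose_smul] at h3
      rw [hVZ, ← Matrix.mul_assoc, h3, Matrix.smul_mul]
    ext a
    exact congrFun (congrFun h1 a) l

end Schmidt

/-! ### The logical algebra of a region is a unital star algebra -/

section EncodedAlgebra

variable {n : ℕ} {G : Type*} [Fintype G] [DecidableEq G]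
  {E : Type*} [NormedAddCommGroup E] [InnerProductSpace ℂ E] [FiniteDimensional ℂ E]

theorem toEuclideanLin_mul_apply {m : Type*} [Fintype m] [DecidableEq m] (X Y : Matrix m m ℂ)
    (ψ : EuclideanSpace ℂ m) :
    toEuclideanLin (X * Y) ψ = toEuclideanLin X (toEuclideanLin Y ψ) := by
  rw [toEuclideanLin, toLpLin_mul_same]
  rfl

/-- The operators on a Hilbert space `E`, encoded in `n` qudits by `V`, that are implemented,
together with their adjoint, by an operator on the region `A`. -/
def encodedAlgebra (V : E →ₗᵢ[ℂ] Hilb n G) (A : Finset (Fin n)) : Set (Module.End ℂ E) :=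
  {T | ∃ O : Matrix (A → G) (A → G) ℂ, ∀ ψ : E,
    toEuclideanLin (onRegion A O) (V ψ) = V (T ψ) ∧
    toEuclideanLin (onRegion A Oᴴ) (V ψ) = V (LinearMap.adjoint T ψ)}

variable {V : E →ₗᵢ[ℂ] Hilb n G} {A : Finset (Fin n)} {S T : Module.End ℂ E}

theorem mem_encodedAlgebra_iff : T ∈ encodedAlgebra V A ↔
    ∃ O : Matrix (A → G) (A → G) ℂ, ∀ ψ : E,
      toEuclideanLin (onRegion A O) (V ψ) = V (T ψ) ∧
      toEuclideanLin (onRegion A Oᴴ) (V ψ) = V (star T ψ) := Iff.rfl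

theorem one_mem_encodedAlgebra : 1 ∈ encodedAlgebra V A :=
  mem_encodedAlgebra_iff.2 ⟨1, fun ψ => by simp [onRegion_one]⟩

theorem mul_mem_encodedAlgebra (hS : S ∈ encodedAlgebra V A) (hT : T ∈ encodedAlgebra V A) :
    S * T ∈ encodedAlgebra V A := by
  rw [mem_encodedAlgebra_iff] at *
  obtain ⟨O, hO⟩ := hS
  obtain ⟨O', hO'⟩ := hT
  refine ⟨O * O', fun ψ => ?_⟩
  rw [conjTranspose_mul, onRegion_mul, onRegion_mul, toEuclideanLin_mul_apply,
    toEuclideanLin_mul_apply, star_mul, (hO' _).1, (hO _).2, (hO _).1, (hO' _).2]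
  exact ⟨rfl, rfl⟩

theorem star_mem_encodedAlgebra (hT : T ∈ encodedAlgebra V A) : star T ∈ encodedAlgebra V A := by
  rw [mem_encodedAlgebra_iff] at *
  obtain ⟨O, hO⟩ := hT
  refine ⟨Oᴴ, fun ψ => ?_⟩
  rw [conjTranspose_conjTranspose, star_star]
  exact ⟨(hO ψ).2, (hO ψ).1⟩

variable (V A) in
/-- `encodedAlgebra` as a subspace of the operators on `E`. -/
def encodedSubspace : Submodule ℂ (Module.End ℂ E) where
  carrier := encodedAlgebra V A
  zero_mem' := mem_encodedAlgebra_iff.2 ⟨0, fun ψ => by simp [onRegion_zero]⟩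
  add_mem' {S T} hS hT := by
    rw [mem_encodedAlgebra_iff] at *
    obtain ⟨O, hO⟩ := hS
    obtain ⟨O', hO'⟩ := hT
    refine ⟨O + O', fun ψ => ?_⟩
    simp [onRegion_add, hO, hO']
  smul_mem' c T hT := by
    rw [mem_encodedAlgebra_iff] at *
    obtain ⟨O, hO⟩ := hT
    refine ⟨c • O, fun ψ => ?_⟩
    simp [onRegion_smul, hO]

end EncodedAlgebra

/-! ### Matrix units of the algebra and of its commutant -/

section MatrixUnits

variable {E : Type*} [NormedAddCommGroup E] [InnerProductSpace ℂ E] [FiniteDimensional ℂ E]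

/-- The operator `|x⟩⟨y|`. -/
noncomputable def ketBra (x y : E) : Module.End ℂ E := (innerₛₗ ℂ y).smulRight x

theorem ketBra_apply (x y z : E) : ketBra x y z = (inner ℂ y z : ℂ) • x := rfl

theorem star_ketBra (x y : E) : star (ketBra x y) = ketBra y x := by
  refine LinearMap.ext fun v => ext_inner_right ℂ fun w => ?_
  rw [inner_star_apply, ketBra_apply, ketBra_apply, inner_smul_left, inner_smul_right,
    inner_conj_symm, mul_comm]

variable {ι : Type*} [Fintype ι] {a b : ι → ℕ}
  (B : OrthonormalBasis (Σ α, Fin (a α) × Fin (b α)) ℂ E)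

/-- The matrix unit `|α,i⟩⟨α,i'| ⊗ 1`. -/
noncomputable def leftUnit (α : ι) (i i' : Fin (a α)) : Module.End ℂ E :=
  ∑ j, ketBra (B ⟨α, (i, j)⟩) (B ⟨α, (i', j)⟩)

/-- The matrix unit `1 ⊗ |α,j⟩⟨α,j'|`. -/
noncomputable def rightUnit (α : ι) (j j' : Fin (b α)) : Module.End ℂ E :=
  ∑ i, ketBra (B ⟨α, (i, j)⟩) (B ⟨α, (i, j')⟩)

theorem star_leftUnit (α : ι) (i i' : Fin (a α)) :
    star (leftUnit B α i i') = leftUnit B α i' i := by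
  simp [leftUnit, star_sum, star_ketBra]

theorem star_rightUnit (α : ι) (j j' : Fin (b α)) :
    star (rightUnit B α j j') = rightUnit B α j' j := by
  simp [rightUnit, star_sum, star_ketBra]

theorem leftUnit_apply_same (α : ι) (i i' k : Fin (a α)) (l : Fin (b α)) :
    leftUnit B α i i' (B ⟨α, (k, l)⟩) = if i' = k then B ⟨α, (i, l)⟩ else 0 := by
  classical
  simp [leftUnit, ketBra_apply, orthonormal_iff_ite.1 B.orthonormal, ite_and]

theorem leftUnit_apply_ne {α β : ι} (h : α ≠ β) (i i' : Fin (a α)) (k : Fin (a β)) (l : Fin (b β)) :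
    leftUnit B α i i' (B ⟨β, (k, l)⟩) = 0 := by
  classical
  simp [leftUnit, ketBra_apply, orthonormal_iff_ite.1 B.orthonormal, h]

theorem rightUnit_apply_same (α : ι) (j j' l : Fin (b α)) (k : Fin (a α)) :
    rightUnit B α j j' (B ⟨α, (k, l)⟩) = if j' = l then B ⟨α, (k, j)⟩ else 0 := by
  classical
  simp [rightUnit, ketBra_apply, orthonormal_iff_ite.1 B.orthonormal, ite_and]

theorem rightUnit_apply_ne {α β : ι} (h : α ≠ β) (j j' : Fin (b α)) (k : Fin (a β))
    (l : Fin (b β)) : rightUnit B α j j' (B ⟨β, (k, l)⟩) = 0 := by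
  classical
  simp [rightUnit, ketBra_apply, orthonormal_iff_ite.1 B.orthonormal, h]

/-- The operators of the form `⊕_α O_α ⊗ 1` in the basis `B`. -/
def IsBlockOp (T : Module.End ℂ E) : Prop :=
  ∃ O : ∀ α, Matrix (Fin (a α)) (Fin (a α)) ℂ, ∀ α i j,
    T (B ⟨α, (i, j)⟩) = ∑ i', O α i' i • B ⟨α, (i', j)⟩

theorem isBlockOp_leftUnit (α : ι) (i i' : Fin (a α)) : IsBlockOp B (leftUnit B α i i') := by
  classical
  refine ⟨Pi.single α (Matrix.single i i' 1), fun β k l => ?_⟩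
  by_cases h : α = β
  · subst h
    rw [leftUnit_apply_same]
    by_cases hk : i' = k
    · simp [hk, Matrix.single_apply, ite_smul]
    · simp [hk]
  · rw [leftUnit_apply_ne B h]
    simp [Pi.single_eq_of_ne (Ne.symm h)]

/-- The two factors act on different indices. This puts the right units in the commutant, where
complementary recovery applies to them. -/
theorem IsBlockOp.mul_rightUnit_comm {T : Module.End ℂ E} (hT : IsBlockOp B T) (α : ι)
    (j j' : Fin (b α)) : T * rightUnit B α j j' = rightUnit B α j j' * T := by
  classical
  obtain ⟨O, hO⟩ := hT
  refine B.toBasis.ext ?_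
  rintro ⟨β, k, l⟩
  rw [OrthonormalBasis.coe_toBasis, Module.End.mul_apply, Module.End.mul_apply, hO]
  by_cases h : α = β
  · subst h
    rw [rightUnit_apply_same, map_sum]
    simp only [map_smul, rightUnit_apply_same]
    by_cases hl : j' = l
    · simp [hl, hO]
    · simp [hl]
  · rw [rightUnit_apply_ne B h, map_zero, map_sum]
    simp [rightUnit_apply_ne B h]

theorem exists_linearIsometry {κ F : Type*} [Fintype κ] [DecidableEq κ] [NormedAddCommGroup F]
    [InnerProductSpace ℂ F] {w : κ → F} (hw : Orthonormal ℂ w) :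
    ∃ U : EuclideanSpace ℂ κ →ₗᵢ[ℂ] F, ∀ k, U (EuclideanSpace.single k 1) = w k := by
  let b := EuclideanSpace.basisFun κ ℂ
  have hb : ∀ k, b.toBasis.constr ℂ w (b k) = w k := fun k => by
    rw [← OrthonormalBasis.coe_toBasis, Module.Basis.constr_basis]
  refine ⟨(b.toBasis.constr ℂ w).isometryOfOrthonormal (v := b.toBasis) ?_ ?_, fun k => ?_⟩
  · rw [OrthonormalBasis.coe_toBasis]
    exact b.orthonormal
  · convert hw
    ext k
    simp
  · rw [← hb k, EuclideanSpace.basisFun_apply]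
    rfl

end MatrixUnits

/-! ### From complementary recovery to isometries on both sides -/

section Existence

variable {n : ℕ} {G : Type*} [Fintype G] [DecidableEq G]
  {E : Type*} [NormedAddCommGroup E] [InnerProductSpace ℂ E] [FiniteDimensional ℂ E]

/-- Moving `O α i` across the inner product leaves `(O α i)ᴴ * O β i'`, which acts on the vectors `u
β k` as a Kronecker delta. -/
theorem orthonormal_of_implement {ι : Type*} [DecidableEq ι] {m : Type*} [Fintype m] [DecidableEq m]
    {a c : ι → ℕ} (O : ∀ α, Fin (a α) → Matrix m m ℂ) (u : ∀ α, Fin (c α) → EuclideanSpace ℂ m)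
    (hu : ∀ α, Orthonormal ℂ (u α))
    (h1 : ∀ α i i' k, toEuclideanLin ((O α i)ᴴ * O α i') (u α k) =
      (if i = i' then (1 : ℂ) else 0) • u α k)
    (h2 : ∀ α β, α ≠ β → ∀ i i' k, toEuclideanLin ((O α i)ᴴ * O β i') (u β k) = 0) :
    Orthonormal ℂ fun p : Σ α, Fin (a α) × Fin (c α) =>
      toEuclideanLin (O p.1 p.2.1) (u p.1 p.2.2) := by
  rw [orthonormal_iff_ite]
  rintro ⟨α, i, k⟩ ⟨β, i', k'⟩
  have h : inner ℂ (toEuclideanLin (O α i) (u α k)) (toEuclideanLin (O β i') (u β k')) =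
      (inner ℂ (u α k) (toEuclideanLin ((O α i)ᴴ * O β i') (u β k')) : ℂ) := by
    rw [toEuclideanLin_mul_apply, toEuclideanLin_conjTranspose_eq_adjoint,
      LinearMap.adjoint_inner_right]
  dsimp only
  rw [h]
  by_cases hαβ : α = β
  · subst hαβ
    rw [h1, inner_smul_right, orthonormal_iff_ite.1 (hu α)]
    by_cases hi : i = i' <;> by_cases hk : k = k' <;> simp [hi, hk]
  · rw [h2 α β hαβ, inner_zero_right]
    simp [hαβ]

/-- Complementary recovery yields a sector decomposition with isometries on both sides. -/
theorem exists_sector_decomposition (V : E →ₗᵢ[ℂ] Hilb n G) (A : Finset (Fin n))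
    (hrec : ∀ T : Module.End ℂ E, (∀ S ∈ encodedAlgebra V A, ∀ ψ, S (T ψ) = T (S ψ)) →
      T ∈ encodedAlgebra V Aᶜ) :
    ∃ (r : ℕ) (a b c d : Fin r → ℕ)
      (B : OrthonormalBasis (Σ α : Fin r, Fin (a α) × Fin (b α)) ℂ E)
      (UA : EuclideanSpace ℂ (Σ α : Fin r, Fin (a α) × Fin (c α)) →ₗᵢ[ℂ] RegionHilb A G)
      (UB : EuclideanSpace ℂ (Σ α : Fin r, Fin (b α) × Fin (d α)) →ₗᵢ[ℂ] RegionHilb Aᶜ G)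
      (χ : ∀ α, EuclideanSpace ℂ (Fin (c α) × Fin (d α))),
      (∀ T : Module.End ℂ E, T ∈ encodedAlgebra V A ↔
        ∃ O : ∀ α, Matrix (Fin (a α)) (Fin (a α)) ℂ, ∀ α i j,
          T (B ⟨α, (i, j)⟩) = ∑ i', O α i' i • B ⟨α, (i', j)⟩) ∧
      (∀ α, ‖χ α‖ = 1) ∧
      ∀ α i j, V (B ⟨α, (i, j)⟩) =
        ∑ k, ∑ l, χ α (k, l) •
          prodVec A (UA (EuclideanSpace.single ⟨α, (i, k)⟩ 1))
            (UB (EuclideanSpace.single ⟨α, (j, l)⟩ 1)) := by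
  obtain ⟨r, a, b, B, ha, hb, hB⟩ := exists_wedderburn_basis (encodedSubspace V A)
    one_mem_encodedAlgebra (fun _ hx _ hy => mul_mem_encodedAlgebra hx hy)
    (fun _ hx => star_mem_encodedAlgebra hx)
  have hB' : ∀ T : Module.End ℂ E, T ∈ encodedAlgebra V A ↔ IsBlockOp B T := hB
  -- Reference indices. Matrix units out of them generate the whole sector from the single vector `ψ
  -- α`.
  let i0 : ∀ α, Fin (a α) := fun α => ⟨0, ha α⟩
  let j0 : ∀ α, Fin (b α) := fun α => ⟨0, hb α⟩
  let ψ : Fin r → Hilb n G := fun α => V (B ⟨α, (i0 α, j0 α)⟩)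
  have hleft : ∀ α i, leftUnit B α i (i0 α) ∈ encodedAlgebra V A := fun α i =>
    (hB' _).2 (isBlockOp_leftUnit B α i _)
  have hright : ∀ α j, rightUnit B α j (j0 α) ∈ encodedAlgebra V Aᶜ := fun α j =>
    hrec _ fun T hT φ =>
      LinearMap.congr_fun (((hB' T).1 hT).mul_rightUnit_comm B α j (j0 α)) φ
  choose O hO using fun α i => mem_encodedAlgebra_iff.1 (hleft α i)
  choose Q hQ using fun α j => mem_encodedAlgebra_iff.1 (hright α j)
  -- The point of this expansion: `ψ β` is an eigenvector of the products in `hOO` and `hQQ`, with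
  -- eigenvalue one or zero, and `huO`, `hvQ` pass the equation on to every support vector.
  choose c d u v χ hu hv hχ hψ huO hvQ using fun α => exists_support_expansion A (ψ α)
  have hOO : ∀ α β i i', toEuclideanLin (onRegion A ((O α i)ᴴ * O β i')) (ψ β) =
      V (leftUnit B α (i0 α) i (B ⟨β, (i', j0 β)⟩)) := fun α β i i' => by
    rw [onRegion_mul, toEuclideanLin_mul_apply, (hO β i' _).1, leftUnit_apply_same, if_pos rfl,
      (hO α i _).2, star_leftUnit]
  have hQQ : ∀ α β j j', toEuclideanLin (onRegion Aᶜ ((Q α j)ᴴ * Q β j')) (ψ β) =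
      V (rightUnit B α (j0 α) j (B ⟨β, (i0 β, j')⟩)) := fun α β j j' => by
    rw [onRegion_mul, toEuclideanLin_mul_apply, (hQ β j' _).1, rightUnit_apply_same, if_pos rfl,
      (hQ α j _).2, star_rightUnit]
  have hA : Orthonormal ℂ fun p : Σ α, Fin (a α) × Fin (c α) =>
      toEuclideanLin (O p.1 p.2.1) (u p.1 p.2.2) := by
    refine orthonormal_of_implement O u hu (fun α i i' k => huO α _ _ ?_ k) fun α β h i i' k => ?_
    · rw [hOO, leftUnit_apply_same]
      split_ifs <;> simp [ψ]
    · rw [huO β _ 0 (by rw [hOO, leftUnit_apply_ne B h, map_zero, zero_smul]), zero_smul]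
  have hC : Orthonormal ℂ fun p : Σ α, Fin (b α) × Fin (d α) =>
      toEuclideanLin (Q p.1 p.2.1) (v p.1 p.2.2) := by
    refine orthonormal_of_implement Q v hv (fun α i i' k => hvQ α _ _ ?_ k) fun α β h i i' k => ?_
    · rw [hQQ, rightUnit_apply_same]
      split_ifs <;> simp [ψ]
    · rw [hvQ β _ 0 (by rw [hQQ, rightUnit_apply_ne B h, map_zero, zero_smul]), zero_smul]
  obtain ⟨UA, hUA⟩ := exists_linearIsometry hA
  obtain ⟨UB, hUB⟩ := exists_linearIsometry hC
  refine ⟨r, a, b, c, d, B, UA, UB, χ, hB, fun α => ?_, fun α i j => ?_⟩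
  · rw [hχ, LinearIsometry.norm_map]
    exact B.orthonormal.norm_eq_one _
  · have h1 : toEuclideanLin (onRegion A (O α i)) (toEuclideanLin (onRegion Aᶜ (Q α j)) (ψ α)) =
        V (B ⟨α, (i, j)⟩) := by
      rw [(hQ α j _).1, rightUnit_apply_same, if_pos rfl, (hO α i _).1, leftUnit_apply_same,
        if_pos rfl]
    rw [← h1, ← toEuclideanLin_mul_apply, onRegion_mul_onRegion_compl]
    nth_rewrite 1 [hψ α]
    simp only [map_sum, map_smul, loc_prodVec, hUA, hUB]

end Existence

/-! ### Weyl systems compatible with the cut -/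

section Weyl

variable {n : ℕ}

/-- A system of Weyl operators `W v = WA v ⊗ WB v` on `H = H_A ⊗ H_{Aᶜ}`, labelled by a finite
abelian group `Λ` that is generated by the labels `ΛA`, `ΛB` of operators on `A` and `Aᶜ`. -/
structure WeylSystem (A : Finset (Fin n)) (G : Type*) [Fintype G] [DecidableEq G] (Λ : Type*)
    [AddCommGroup Λ] [Fintype Λ] where
  WA : Λ → Matrix (A → G) (A → G) ℂ
  WB : Λ → Matrix (↥Aᶜ → G) (↥Aᶜ → G) ℂ
  ΛA : AddSubgroup Λ
  ΛB : AddSubgroup Λ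
  /-- The commutation phases. -/
  form : Λ →+ AddChar Λ ℂ
  form_injective : Function.Injective form
  form_mul_swap : ∀ v w, form v w * form w v = 1
  form_eq_one : ∀ v ∈ ΛA, ∀ w ∈ ΛB, form v w = 1
  sup_eq_top : ΛA ⊔ ΛB = ⊤
  WA_eq_one : ∀ v ∈ ΛB, WA v = 1
  WB_eq_one : ∀ v ∈ ΛA, WB v = 1
  trace_WB : ∀ v, v ∉ ΛA → (WB v).trace = 0
  WA_unitary : ∀ v, WA v * (WA v)ᴴ = 1
  WB_unitary : ∀ v, WB v * (WB v)ᴴ = 1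
  mul : ∀ v w, ∃ c : ℂ, ‖c‖ = 1 ∧ loc A (WA v) (WB v) * loc A (WA w) (WB w) =
    c • loc A (WA (v + w)) (WB (v + w))
  comm : ∀ v w, loc A (WA v) (WB v) * loc A (WA w) (WB w) =
    form v w • (loc A (WA w) (WB w) * loc A (WA v) (WB v))
  span : ∀ X : Matrix (Fin n → G) (Fin n → G) ℂ, ∃ t : Λ → ℂ,
    X = ∑ v, t v • loc A (WA v) (WB v)

namespace WeylSystem

variable {A : Finset (Fin n)} {G : Type*} [Fintype G] [DecidableEq G] {Λ : Type*}
  [AddCommGroup Λ] [Fintype Λ] (𝒲 : WeylSystem A G Λ)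

/-- The Weyl operators. -/
def W (v : Λ) : Matrix (Fin n → G) (Fin n → G) ℂ := loc A (𝒲.WA v) (𝒲.WB v)

theorem W_mul_conjTranspose (v : Λ) : 𝒲.W v * (𝒲.W v)ᴴ = 1 := by
  rw [W, loc_conjTranspose, loc_mul_loc, 𝒲.WA_unitary, 𝒲.WB_unitary, loc_one_one]

theorem conjTranspose_mul_W (v : Λ) : (𝒲.W v)ᴴ * 𝒲.W v = 1 :=
  mul_eq_one_comm.1 (𝒲.W_mul_conjTranspose v)

theorem W_mul (v w : Λ) : ∃ c : ℂ, ‖c‖ = 1 ∧ 𝒲.W v * 𝒲.W w = c • 𝒲.W (v + w) := 𝒲.mul v w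

theorem W_comm (v w : Λ) : 𝒲.W v * 𝒲.W w = 𝒲.form v w • (𝒲.W w * 𝒲.W v) := 𝒲.comm v w

theorem onRegion_WA {v : Λ} (hv : v ∈ 𝒲.ΛA) : onRegion A (𝒲.WA v) = 𝒲.W v := by
  rw [onRegion_eq_loc, W, 𝒲.WB_eq_one v hv]

theorem onRegion_WB {v : Λ} (hv : v ∈ 𝒲.ΛB) : onRegion Aᶜ (𝒲.WB v) = 𝒲.W v := by
  rw [onRegion_compl_eq_loc, W, 𝒲.WA_eq_one v hv]

theorem W_zero : ∃ c : ℂ, 𝒲.W 0 = c • 1 := by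
  obtain ⟨c, -, hc⟩ := 𝒲.W_mul 0 0
  refine ⟨c, ?_⟩
  have h := congrArg (fun X => (𝒲.W 0)ᴴ * X) hc
  simpa only [add_zero, ← mul_assoc, conjTranspose_mul_W, one_mul, mul_smul_comm] using h

theorem W_neg (v : Λ) : ∃ c : ℂ, 𝒲.W (-v) = c • (𝒲.W v)ᴴ := by
  obtain ⟨c, -, hc⟩ := 𝒲.W_mul (-v) v
  obtain ⟨c', hc'⟩ := 𝒲.W_zero
  refine ⟨c * c', ?_⟩
  rw [neg_add_cancel, hc', smul_smul] at hc
  have h := congrArg (fun X => X * (𝒲.W v)ᴴ) hc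
  simpa only [mul_assoc, W_mul_conjTranspose, mul_one, smul_mul_assoc, one_mul] using h

theorem form_eq_one_comm {v w : Λ} : 𝒲.form v w = 1 ↔ 𝒲.form w v = 1 := by
  have := 𝒲.form_mul_swap v w
  constructor <;> intro h <;> simpa [h] using this

theorem W_conj (v w : Λ) : (𝒲.W w)ᴴ * 𝒲.W v * 𝒲.W w = 𝒲.form v w • 𝒲.W v := by
  rw [mul_assoc, W_comm, mul_smul_comm, ← mul_assoc, conjTranspose_mul_W, one_mul]

theorem conjTranspose_W_comm {X : Matrix (Fin n → G) (Fin n → G) ℂ} {v : Λ}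
    (h : 𝒲.W v * X = X * 𝒲.W v) : (𝒲.W v)ᴴ * X = X * (𝒲.W v)ᴴ := by
  calc (𝒲.W v)ᴴ * X = (𝒲.W v)ᴴ * (X * 𝒲.W v) * (𝒲.W v)ᴴ := by
        rw [mul_assoc, mul_assoc X, W_mul_conjTranspose, mul_one]
    _ = X * (𝒲.W v)ᴴ := by rw [← h, ← mul_assoc, conjTranspose_mul_W, one_mul]

/-- The labels of the Weyl operators that commute with `X`. -/
def commSubgroup (X : Matrix (Fin n → G) (Fin n → G) ℂ) : AddSubgroup Λ where
  carrier := {v | 𝒲.W v * X = X * 𝒲.W v}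
  zero_mem' := by
    obtain ⟨c, hc⟩ := 𝒲.W_zero
    simp [hc]
  add_mem' {v w} hv hw := by
    simp only [Set.mem_ofPred_eq] at *
    obtain ⟨c, hc1, hc⟩ := 𝒲.W_mul v w
    have hc0 : c ≠ 0 := norm_ne_zero_iff.1 (by rw [hc1]; exact one_ne_zero)
    have h : 𝒲.W (v + w) = c⁻¹ • (𝒲.W v * 𝒲.W w) := by
      rw [hc, smul_smul, inv_mul_cancel₀ hc0, one_smul]
    rw [h, smul_mul_assoc, mul_smul_comm, mul_assoc, hw, ← mul_assoc, hv, mul_assoc]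
  neg_mem' {v} hv := by
    simp only [Set.mem_ofPred_eq] at *
    obtain ⟨c, hc⟩ := 𝒲.W_neg v
    rw [hc, smul_mul_assoc, mul_smul_comm, 𝒲.conjTranspose_W_comm hv]

theorem mem_commSubgroup {X : Matrix (Fin n → G) (Fin n → G) ℂ} {v : Λ} :
    v ∈ 𝒲.commSubgroup X ↔ 𝒲.W v * X = X * 𝒲.W v := Iff.rfl

/-- The labels of the Weyl operators that commute with those labelled by `H`. -/
def perp (H : AddSubgroup Λ) : AddSubgroup Λ where
  carrier := {v | ∀ h ∈ H, 𝒲.form v h = 1}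
  zero_mem' := by simp
  add_mem' {v w} hv hw h hh := by
    rw [map_add, AddChar.add_apply, hv h hh, hw h hh, one_mul]
  neg_mem' {v} hv h hh := by
    rw [map_neg, AddChar.neg_apply, AddChar.map_neg_eq_inv, hv h hh, inv_one]

theorem mem_perp {H : AddSubgroup Λ} {v : Λ} : v ∈ 𝒲.perp H ↔ ∀ h ∈ H, 𝒲.form v h = 1 := Iff.rfl

theorem W_comm_of_mem_perp {H : AddSubgroup Λ} {v h : Λ} (hv : v ∈ 𝒲.perp H) (hh : h ∈ H) :
    𝒲.W v * 𝒲.W h = 𝒲.W h * 𝒲.W v := by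
  rw [W_comm, hv h hh, one_smul]

theorem form_bijective : Function.Bijective 𝒲.form := by
  classical
  exact (Fintype.bijective_iff_injective_and_card _).2 ⟨𝒲.form_injective, AddChar.card_eq.symm⟩

/-- If `v ∉ H`, some character of `Λ / H` is nontrivial at `v`. By nondegeneracy it is `form w` for
some `w`, which then lies in `perp H`. -/
theorem mem_of_forall_perp {H : AddSubgroup Λ} {v : Λ}
    (hv : ∀ w ∈ 𝒲.perp H, 𝒲.form w v = 1) : v ∈ H := by
  by_contra hvH
  have h0 : (QuotientAddGroup.mk' H v) ≠ 0 := fun h => hvH ((QuotientAddGroup.eq_zero_iff v).1 h)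
  obtain ⟨ψ, hψ⟩ := AddChar.exists_apply_ne_zero.2 h0
  obtain ⟨w, hw⟩ := 𝒲.form_bijective.2 (ψ.compAddMonoidHom (QuotientAddGroup.mk' H))
  refine hψ ?_
  rw [← AddChar.compAddMonoidHom_apply, ← hw]
  refine hv w fun h hh => ?_
  rw [hw, AddChar.compAddMonoidHom_apply, QuotientAddGroup.mk'_apply,
    (QuotientAddGroup.eq_zero_iff h).2 hh, AddChar.map_zero_eq_one]

/-- Write `w = a + b`. The summand `b` pairs trivially with `ΛB`, because `w` and `a` do, and with
`ΛA` by assumption on the system; nondegeneracy gives `b = 0`. -/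
theorem perp_ΛB_le : 𝒲.perp 𝒲.ΛB ≤ 𝒲.ΛA := by
  intro w hw
  obtain ⟨a, ha, b, hb, rfl⟩ := AddSubgroup.mem_sup.1 (𝒲.sup_eq_top ▸ AddSubgroup.mem_top w)
  suffices b = 0 by rwa [this, add_zero]
  apply 𝒲.form_injective
  rw [map_zero]
  ext x
  obtain ⟨a', ha', b', hb', rfl⟩ := AddSubgroup.mem_sup.1 (𝒲.sup_eq_top ▸ AddSubgroup.mem_top x)
  have h1 := hw b' hb'
  rw [map_add, AddChar.add_apply, 𝒲.form_eq_one a ha b' hb', one_mul] at h1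
  rw [AddChar.map_add_eq_mul, h1, 𝒲.form_eq_one_comm.1 (𝒲.form_eq_one a' ha' b hb)]
  simp

/-- An operator that commutes with the Weyl operators labelled by `U` is a combination of Weyl
operators that commute with them. -/
theorem exists_expansion {X : Matrix (Fin n → G) (Fin n → G) ℂ} {U : AddSubgroup Λ}
    (hU : U ≤ 𝒲.commSubgroup X) :
    ∃ t : Λ → ℂ, X = ∑ v, t v • 𝒲.W v ∧ ∀ v, t v ≠ 0 → v ∈ 𝒲.perp U := by
  classical
  have := Fintype.ofFinite U
  obtain ⟨t, ht⟩ := 𝒲.span X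
  have ht' : X = ∑ v, t v • 𝒲.W v := ht
  have hcard : (Fintype.card U : ℂ) ≠ 0 := Nat.cast_ne_zero.2 Fintype.card_ne_zero
  -- Conjugation by each `W u`, `u ∈ U`, fixes `X` and multiplies `t v` by `form v u`. Averaging
  -- over `U`, character orthogonality leaves exactly the labels in `perp U`, without appeal to
  -- linear independence of the `W v`.
  refine ⟨fun v => if v ∈ 𝒲.perp U then t v else 0, ?_, fun v hv => by
    by_contra h
    simp [h] at hv⟩
  have h1 : ∀ u : U, X = ∑ v, (t v * 𝒲.form v u) • 𝒲.W v := fun u => by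
    have h2 : X = (𝒲.W u)ᴴ * X * 𝒲.W u := by
      rw [𝒲.conjTranspose_W_comm (hU u.2), mul_assoc, conjTranspose_mul_W, mul_one]
    nth_rewrite 1 [h2, ht']
    simp only [Finset.mul_sum, Finset.sum_mul, mul_smul_comm, smul_mul_assoc, W_conj, smul_smul]
  have h3 : ∀ v, ∑ u : U, 𝒲.form v u = if v ∈ 𝒲.perp U then (Fintype.card U : ℂ) else 0 := by
    intro v
    have h4 := AddChar.sum_eq_ite ((𝒲.form v).compAddMonoidHom U.subtype)
    simp only [AddChar.compAddMonoidHom_apply, AddSubgroup.subtype_apply] at h4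
    rw [h4]
    congr 1
    simp only [mem_perp, AddChar.ext_iff, AddChar.compAddMonoidHom_apply, AddChar.zero_apply,
      Subtype.forall, AddSubgroup.subtype_apply]
  have h5 : (Fintype.card U : ℂ) • X =
      (Fintype.card U : ℂ) • ∑ v, (if v ∈ 𝒲.perp U then t v else 0) • 𝒲.W v := by
    calc (Fintype.card U : ℂ) • X = ∑ u : U, X := by simp [Nat.cast_smul_eq_nsmul]
      _ = ∑ u : U, ∑ v, (t v * 𝒲.form v u) • 𝒲.W v := Finset.sum_congr rfl fun u _ => h1 u
      _ = _ := by
        rw [Finset.sum_comm, Finset.smul_sum]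
        refine Finset.sum_congr rfl fun v _ => ?_
        rw [← Finset.sum_smul, ← Finset.mul_sum, h3, smul_smul]
        split_ifs <;> simp [mul_comm]
  exact smul_right_injective _ hcard h5

end WeylSystem

end Weyl

/-! ### Compression of physical operators to the code -/

section Logical

variable {n : ℕ} {G : Type*} [Fintype G] [DecidableEq G]
  {E : Type*} [NormedAddCommGroup E] [InnerProductSpace ℂ E] [FiniteDimensional ℂ E]
  (V : E →ₗᵢ[ℂ] Hilb n G)

theorem inner_toEuclideanLin_left {m : Type*} [Fintype m] [DecidableEq m] (X : Matrix m m ℂ)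
    (φ ψ : EuclideanSpace ℂ m) :
    inner ℂ (toEuclideanLin Xᴴ φ) ψ = (inner ℂ φ (toEuclideanLin X ψ) : ℂ) := by
  rw [toEuclideanLin_conjTranspose_eq_adjoint, LinearMap.adjoint_inner_left]

theorem adjoint_isometry_apply (η : E) : LinearMap.adjoint V.toLinearMap (V η) = η := by
  refine ext_inner_right ℂ fun w => ?_
  rw [LinearMap.adjoint_inner_left]
  exact V.inner_map_map η w

/-- The compression of an operator to the encoded space. -/
noncomputable def logical (X : Matrix (Fin n → G) (Fin n → G) ℂ) : Module.End ℂ E :=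
  LinearMap.adjoint V.toLinearMap ∘ₗ toEuclideanLin X ∘ₗ V.toLinearMap

theorem map_logical {X : Matrix (Fin n → G) (Fin n → G) ℂ} {ψ : E}
    (h : ∃ η, V η = toEuclideanLin X (V ψ)) : V (logical V X ψ) = toEuclideanLin X (V ψ) := by
  obtain ⟨η, hη⟩ := h
  simp only [logical, LinearMap.comp_apply, LinearIsometry.coe_toLinearMap]
  rw [← hη, adjoint_isometry_apply]

theorem star_logical (X : Matrix (Fin n → G) (Fin n → G) ℂ) :
    star (logical V X) = logical V Xᴴ := by
  refine LinearMap.ext fun φ => ext_inner_right ℂ fun ψ => ?_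
  rw [inner_star_apply]
  simp only [logical, LinearMap.comp_apply]
  rw [LinearMap.adjoint_inner_left, LinearMap.adjoint_inner_right, inner_toEuclideanLin_left]

/-- An operator on the physical space that implements `T`, and whose adjoint preserves the code,
also implements the adjoint of `T`. -/
theorem implements_star {X : Matrix (Fin n → G) (Fin n → G) ℂ} {T : Module.End ℂ E}
    (hX : ∀ ψ, toEuclideanLin X (V ψ) = V (T ψ)) (hX' : ∀ ψ, ∃ η, V η = toEuclideanLin Xᴴ (V ψ))
    (ψ : E) : toEuclideanLin Xᴴ (V ψ) = V (star T ψ) := by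
  obtain ⟨η, hη⟩ := hX' ψ
  rw [← hη]
  congr 1
  refine ext_inner_right ℂ fun φ => ?_
  rw [inner_star_apply, ← V.inner_map_map, hη, inner_toEuclideanLin_left, hX, V.inner_map_map]

end Logical

/-! ### Stabilizer encodings and complementary recovery -/

section StabilizerEncoding

variable {n : ℕ} {A : Finset (Fin n)} {G : Type*} [Fintype G] [DecidableEq G] {Λ : Type*}
  [AddCommGroup Λ] [Fintype Λ]
  {E : Type*} [NormedAddCommGroup E] [InnerProductSpace ℂ E] [FiniteDimensional ℂ E]

/-- The image of `V` is the simultaneous `+1` eigenspace of the operators `z s • W s`, `s ∈ S`. -/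
structure IsStabilizerEncoding (𝒲 : WeylSystem A G Λ) (V : E →ₗᵢ[ℂ] Hilb n G) (S : AddSubgroup Λ)
    (z : Λ → ℂ) : Prop where
  fix : ∀ s ∈ S, ∀ ψ, z s • toEuclideanLin (𝒲.W s) (V ψ) = V ψ
  range : ∀ φ, (∀ s ∈ S, z s • toEuclideanLin (𝒲.W s) φ = φ) → ∃ η, V η = φ

namespace IsStabilizerEncoding

variable {𝒲 : WeylSystem A G Λ} {V : E →ₗᵢ[ℂ] Hilb n G} {S : AddSubgroup Λ} {z : Λ → ℂ}
  (h : IsStabilizerEncoding 𝒲 V S z)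

include h

theorem phase_ne_zero [Nontrivial E] {s : Λ} (hs : s ∈ S) : z s ≠ 0 := by
  obtain ⟨ψ, hψ⟩ := exists_ne (0 : E)
  intro h0
  have := h.fix s hs ψ
  rw [h0, zero_smul] at this
  exact hψ (V.injective (by rw [← this, map_zero]))

theorem W_apply [Nontrivial E] {s : Λ} (hs : s ∈ S) (ψ : E) :
    toEuclideanLin (𝒲.W s) (V ψ) = (z s)⁻¹ • V ψ := by
  rw [eq_inv_smul_iff₀ (h.phase_ne_zero hs), h.fix s hs]

/-- The Weyl operators that commute with the stabilizer preserve the code. -/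
theorem preserves {X : Matrix (Fin n → G) (Fin n → G) ℂ}
    (hX : ∀ s ∈ S, 𝒲.W s * X = X * 𝒲.W s) (ψ : E) : ∃ η, V η = toEuclideanLin X (V ψ) := by
  refine h.range _ fun s hs => ?_
  rw [← toEuclideanLin_mul_apply, hX s hs, toEuclideanLin_mul_apply, ← map_smul, h.fix s hs]

theorem map_logical_W {v : Λ} (hv : v ∈ 𝒲.perp S) (ψ : E) :
    V (logical V (𝒲.W v) ψ) = toEuclideanLin (𝒲.W v) (V ψ) :=
  map_logical V (h.preserves (fun _ hs => (𝒲.W_comm_of_mem_perp hv hs).symm) ψ)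

theorem map_logical_W_conjTranspose {v : Λ} (hv : v ∈ 𝒲.perp S) (ψ : E) :
    V (logical V (𝒲.W v)ᴴ ψ) = toEuclideanLin (𝒲.W v)ᴴ (V ψ) :=
  map_logical V (h.preserves
    (fun _ hs => (𝒲.conjTranspose_W_comm (𝒲.W_comm_of_mem_perp hv hs)).symm) ψ)

theorem logical_W_mem_encodedAlgebra {v : Λ} (hv : v ∈ 𝒲.perp S) (hvA : v ∈ 𝒲.ΛA) :
    logical V (𝒲.W v) ∈ encodedAlgebra V A := by
  refine mem_encodedAlgebra_iff.2 ⟨𝒲.WA v, fun ψ => ?_⟩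
  rw [onRegion_conjTranspose, 𝒲.onRegion_WA hvA, star_logical, h.map_logical_W hv,
    h.map_logical_W_conjTranspose hv]
  exact ⟨rfl, rfl⟩

/-- Tested against code vectors, only the adjoint of `W v` meets the code, and it preserves the
code. -/
theorem adjoint_W_apply {v : Λ} (hv : v ∈ 𝒲.perp S) (φ : Hilb n G) :
    LinearMap.adjoint V.toLinearMap (toEuclideanLin (𝒲.W v) φ) =
      logical V (𝒲.W v) (LinearMap.adjoint V.toLinearMap φ) := by
  refine ext_inner_left ℂ fun ψ => ?_
  rw [LinearMap.adjoint_inner_right, ← inner_toEuclideanLin_left, ← inner_star_apply, star_logical,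
    LinearMap.adjoint_inner_right, LinearIsometry.coe_toLinearMap,
    h.map_logical_W_conjTranspose hv]

/-- Both operators act as nonzero scalars on a common nonzero code vector, which forces their
commutation phase to be one. -/
theorem isotropic [Nontrivial E] : S ≤ 𝒲.perp S := by
  intro s hs t ht
  obtain ⟨ψ, hψ⟩ := exists_ne (0 : E)
  have h1 := congrArg (fun X => toEuclideanLin X (V ψ)) (𝒲.W_comm s t)
  simp only [map_smul, LinearMap.smul_apply, toEuclideanLin_mul_apply, h.W_apply hs,
    h.W_apply ht, smul_smul] at h1
  have h2 : V ψ ≠ 0 := fun h0 => hψ (V.injective (by rw [h0, map_zero]))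
  have h3 := smul_left_injective ℂ h2 h1
  have h4 : (z t)⁻¹ * (z s)⁻¹ ≠ 0 :=
    mul_ne_zero (inv_ne_zero (h.phase_ne_zero ht)) (inv_ne_zero (h.phase_ne_zero hs))
  rw [mul_comm (z s)⁻¹] at h3
  exact mul_right_cancel₀ h4 (by rw [one_mul, ← h3])

/-- A logical operator that commutes with the logical Weyl operators labelled by `R^⊥`, where
`S ≤ R`, is a combination of Weyl operators labelled by `R ∩ S^⊥`. -/
theorem exists_expansion [Nontrivial E] {R : AddSubgroup Λ} (hSR : S ≤ R) {T : Module.End ℂ E}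
    (hT : ∀ w ∈ 𝒲.perp R, ∀ ψ, logical V (𝒲.W w) (T ψ) = T (logical V (𝒲.W w) ψ)) :
    ∃ t : Λ → ℂ, (∀ v, t v ≠ 0 → v ∈ R ∧ v ∈ 𝒲.perp S) ∧
      ∀ ψ, V (T ψ) = ∑ v, t v • toEuclideanLin (𝒲.W v) (V ψ) := by
  -- `T` extended by zero off the code, so that the expansion of physical operators applies.
  let X : Matrix (Fin n → G) (Fin n → G) ℂ :=
    toEuclideanLin.symm (V.toLinearMap ∘ₗ T ∘ₗ LinearMap.adjoint V.toLinearMap)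
  have hX : ∀ φ, toEuclideanLin X φ = V (T (LinearMap.adjoint V.toLinearMap φ)) := fun φ => by
    rw [LinearEquiv.apply_symm_apply]
    rfl
  have hcomm : ∀ v ∈ 𝒲.perp S,
      (∀ ψ, logical V (𝒲.W v) (T ψ) = T (logical V (𝒲.W v) ψ)) → v ∈ 𝒲.commSubgroup X := by
    intro v hv hvT
    rw [𝒲.mem_commSubgroup]
    apply toEuclideanLin.injective
    ext1 φ
    rw [toEuclideanLin_mul_apply, toEuclideanLin_mul_apply, hX, hX, h.adjoint_W_apply hv, ← hvT,
      h.map_logical_W hv]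
  have hS : ∀ s ∈ S, ∀ ψ, logical V (𝒲.W s) ψ = (z s)⁻¹ • ψ := fun s hs ψ => by
    apply V.injective
    rw [h.map_logical_W (h.isotropic hs), h.W_apply hs, map_smul]
  have hperp : 𝒲.perp R ≤ 𝒲.perp S := fun v hv s hs => hv s (hSR hs)
  -- Commuting with `perp R` confines the labels to the double complement of `R`, which is `R`;
  -- commuting with `S` confines them to `perp S`.
  obtain ⟨t, ht, ht'⟩ := 𝒲.exists_expansion (X := X) (U := 𝒲.perp R ⊔ S)
    (sup_le (fun w hw => hcomm w (hperp hw) (hT w hw)) fun s hs => hcomm s (h.isotropic hs)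
      fun ψ => by rw [hS s hs, hS s hs, map_smul])
  refine ⟨t, fun v hv => ⟨𝒲.mem_of_forall_perp fun w hw => ?_, fun s hs => ?_⟩, fun ψ => ?_⟩
  · exact 𝒲.form_eq_one_comm.1 (ht' v hv w (AddSubgroup.mem_sup_left hw))
  · exact ht' v hv s (AddSubgroup.mem_sup_right hs)
  · have := hX (V ψ)
    rw [adjoint_isometry_apply] at this
    rw [← this]
    nth_rewrite 1 [ht]
    simp only [map_sum, map_smul, LinearMap.sum_apply, LinearMap.smul_apply]

/-- The logical Weyl operators act irreducibly on the code. -/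
theorem eq_smul_of_commute [Nontrivial E] {T : Module.End ℂ E}
    (hT : ∀ w ∈ 𝒲.perp S, ∀ ψ, logical V (𝒲.W w) (T ψ) = T (logical V (𝒲.W w) ψ)) :
    ∃ c : ℂ, ∀ ψ, T ψ = c • ψ := by
  -- With `R = S` only stabilizer labels remain, and these act as scalars.
  obtain ⟨t, ht, htT⟩ := h.exists_expansion le_rfl hT
  refine ⟨∑ v, t v * (z v)⁻¹, fun ψ => V.injective ?_⟩
  rw [htT, map_smul, Finset.sum_smul]
  refine Finset.sum_congr rfl fun v _ => ?_
  by_cases hv : t v = 0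
  · simp [hv]
  · rw [h.W_apply (ht v hv).1, smul_smul]

/-- Complementary recovery for stabilizer codes. -/
theorem complementary_recovery [Nontrivial E] {T : Module.End ℂ E}
    (hT : ∀ Y ∈ encodedAlgebra V A, ∀ ψ, Y (T ψ) = T (Y ψ)) : T ∈ encodedAlgebra V Aᶜ := by
  -- The complement of `S ⊔ ΛB` lies in `perp S ∩ ΛA`, so its Weyl operators are logical operators
  -- of `A` and commute with `T`.
  obtain ⟨t, ht, htT⟩ := h.exists_expansion (R := S ⊔ 𝒲.ΛB) le_sup_left (T := T) fun w hw ψ =>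
    hT _ (h.logical_W_mem_encodedAlgebra (fun s hs => hw s (AddSubgroup.mem_sup_left hs))
      (𝒲.perp_ΛB_le fun s hs => hw s (AddSubgroup.mem_sup_right hs))) ψ
  -- A label `s + b` acts on the code as a multiple of `W b`, which lives on `Aᶜ`; `b` stays in
  -- `perp S` because `S` is isotropic.
  have hex : ∀ v, ∃ (k : ℂ) (b : Λ), b ∈ 𝒲.ΛB ∧ b ∈ 𝒲.perp S ∧
      ∀ ψ, t v • toEuclideanLin (𝒲.W v) (V ψ) = k • toEuclideanLin (𝒲.W b) (V ψ) := by
    intro v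
    by_cases hv : t v = 0
    · exact ⟨0, 0, zero_mem _, zero_mem _, fun ψ => by simp [hv]⟩
    · obtain ⟨hvR, hvS⟩ := ht v hv
      obtain ⟨s, hs, b, hb, rfl⟩ := AddSubgroup.mem_sup.1 hvR
      obtain ⟨c, hc1, hc⟩ := 𝒲.W_mul b s
      have hc0 : c ≠ 0 := norm_ne_zero_iff.1 (by rw [hc1]; exact one_ne_zero)
      refine ⟨t (s + b) * (c⁻¹ * (z s)⁻¹), b, hb, ?_, fun ψ => ?_⟩
      · have := sub_mem hvS (h.isotropic hs)
        rwa [add_sub_cancel_left] at this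
      · have h1 : 𝒲.W (s + b) = c⁻¹ • (𝒲.W b * 𝒲.W s) := by
          rw [hc, smul_smul, inv_mul_cancel₀ hc0, one_smul, add_comm]
        rw [h1, map_smul, LinearMap.smul_apply, toEuclideanLin_mul_apply, h.W_apply hs, map_smul]
        simp only [smul_smul]
  choose k b hbB hbS hk using hex
  have hQ : onRegion Aᶜ (∑ v, k v • 𝒲.WB (b v)) = ∑ v, k v • 𝒲.W (b v) := by
    simp only [onRegion_sum, onRegion_smul, 𝒲.onRegion_WB (hbB _)]
  have hX : ∀ ψ, toEuclideanLin (onRegion Aᶜ (∑ v, k v • 𝒲.WB (b v))) (V ψ) = V (T ψ) := fun ψ => by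
    rw [hQ, htT]
    simp only [map_sum, map_smul, LinearMap.sum_apply, LinearMap.smul_apply, hk]
  refine mem_encodedAlgebra_iff.2 ⟨∑ v, k v • 𝒲.WB (b v), fun ψ => ⟨hX ψ, ?_⟩⟩
  rw [onRegion_conjTranspose]
  refine implements_star V hX (fun ψ => h.preserves (fun s hs => ?_) ψ) ψ
  rw [hQ, conjTranspose_sum, Finset.mul_sum, Finset.sum_mul]
  refine Finset.sum_congr rfl fun v _ => ?_
  rw [conjTranspose_smul, mul_smul_comm, smul_mul_assoc,
    𝒲.conjTranspose_W_comm (𝒲.W_comm_of_mem_perp (hbS v) hs)]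

end IsStabilizerEncoding

end StabilizerEncoding

/-! ### Entropy of a flat spectrum -/

section Entropy

theorem reduced_eq_mul {c d : ℕ} (χ : EuclideanSpace ℂ (Fin c × Fin d)) :
    reduced χ = (Matrix.of fun k l => χ (k, l)) * (Matrix.of fun k l => χ (k, l))ᴴ := by
  ext k k'
  simp [reduced, Matrix.mul_apply]

theorem trace_reduced {c d : ℕ} {χ : EuclideanSpace ℂ (Fin c × Fin d)} (hχ : ‖χ‖ = 1) :
    (reduced χ).trace = 1 := by
  have h : (inner ℂ χ χ : ℂ) = 1 := by
    rw [inner_self_eq_norm_sq_to_K, hχ]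
    simp
  rw [← h, PiLp.inner_apply, Fintype.sum_prod_type]
  rfl

/-- The entropy of a state with flat spectrum. -/
theorem entropy_eq_of_mul_self {c d : ℕ} {χ : EuclideanSpace ℂ (Fin c × Fin d)} (hχ : ‖χ‖ = 1)
    {μ : ℂ} (h : reduced χ * reduced χ = μ • reduced χ) : entropy χ = -Real.log μ.re := by
  set e := (reduced_isHermitian χ).eigenvalues with he
  have hev : ∀ k, e k = 0 ∨ e k = μ.re := by
    intro k
    set v : EuclideanSpace ℂ (Fin c) := (reduced_isHermitian χ).eigenvectorBasis k
    have hv : reduced χ *ᵥ v = (e k : ℂ) • (v : Fin c → ℂ) := by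
      have := (reduced_isHermitian χ).mulVec_eigenvectorBasis k
      rw [this]
      ext i
      simp [v, he]
    have hv0 : (v : Fin c → ℂ) ≠ 0 := fun h0 =>
      (reduced_isHermitian χ).eigenvectorBasis.orthonormal.ne_zero k (by
        ext i
        exact congrFun h0 i)
    have h1 := congrArg (fun X => X *ᵥ (v : Fin c → ℂ)) h
    simp only [← Matrix.mulVec_mulVec, Matrix.smul_mulVec, hv, Matrix.mulVec_smul, smul_smul] at h1
    have h2 : (e k : ℂ) * e k = μ * e k := smul_left_injective ℂ hv0 h1
    by_cases h0 : e k = 0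
    · exact Or.inl h0
    · right
      have h3 : (e k : ℂ) = μ := mul_right_cancel₀ (by exact_mod_cast h0) h2
      rw [← h3, Complex.ofReal_re]
  have hsum : ∑ k, e k = 1 := by
    have := (reduced_isHermitian χ).trace_eq_sum_eigenvalues
    rw [trace_reduced hχ] at this
    apply Complex.ofReal_injective
    rw [Complex.ofReal_one, this, Complex.ofReal_sum]
    rfl
  -- Linear in the eigenvalue, also at zero; as the eigenvalues sum to one, their multiplicities
  -- never have to be counted.
  have hneg : ∀ k, Real.negMulLog (e k) = -Real.log μ.re * e k := by
    intro k
    rcases hev k with h0 | h0 <;> rw [h0]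
    · simp
    · rw [Real.negMulLog]
      ring
  rw [entropy, ← he, Finset.sum_congr rfl fun k _ => hneg k, ← Finset.mul_sum, hsum, mul_one]

end Entropy

/-! ### Partial trace -/

section PartialTrace

variable {n : ℕ} {G : Type*} [Fintype G] [DecidableEq G]

/-- The partial trace over the complement of `A`. -/
def partialTrace (A : Finset (Fin n)) (X : Matrix (Fin n → G) (Fin n → G) ℂ) :
    Matrix (A → G) (A → G) ℂ :=
  Matrix.of fun a a' => ∑ b, X ((splitEquiv A G).symm (a, b)) ((splitEquiv A G).symm (a', b))

variable (A : Finset (Fin n))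

theorem partialTrace_loc (O : Matrix (A → G) (A → G) ℂ) (Q : Matrix (↥Aᶜ → G) (↥Aᶜ → G) ℂ) :
    partialTrace A (loc A O Q) = Q.trace • O := by
  ext a a'
  simp [partialTrace, loc, Matrix.kroneckerMap_apply, Matrix.trace, ← Finset.mul_sum, mul_comm]

theorem partialTrace_smul (c : ℂ) (X : Matrix (Fin n → G) (Fin n → G) ℂ) :
    partialTrace A (c • X) = c • partialTrace A X := by
  ext a a'
  simp [partialTrace, Finset.mul_sum]

theorem partialTrace_sum {ι : Type*} (s : Finset ι) (X : ι → Matrix (Fin n → G) (Fin n → G) ℂ) :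
    partialTrace A (∑ i ∈ s, X i) = ∑ i ∈ s, partialTrace A (X i) := by
  ext a a'
  simp only [partialTrace, Matrix.of_apply, Matrix.sum_apply]
  exact Finset.sum_comm

theorem partialTrace_vecMulVec (ψ : Hilb n G) :
    partialTrace A (Matrix.vecMulVec ψ (star ψ)) = coeffMatrix A ψ * (coeffMatrix A ψ)ᴴ := by
  ext a a'
  simp only [partialTrace, Matrix.mul_apply, Matrix.of_apply, Matrix.vecMulVec_apply]
  rfl

end PartialTrace

/-! ### Flatness of the sector states -/

section Flat

variable {n : ℕ} {A : Finset (Fin n)} {G : Type*} [Fintype G] [DecidableEq G]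
  {E : Type*} [NormedAddCommGroup E] [InnerProductSpace ℂ E] [FiniteDimensional ℂ E]

theorem orthonormal_map_single {κ F : Type*} [Fintype κ] [DecidableEq κ] [NormedAddCommGroup F]
    [InnerProductSpace ℂ F] (U : EuclideanSpace ℂ κ →ₗᵢ[ℂ] F) :
    Orthonormal ℂ fun k => U (EuclideanSpace.single k 1) := by
  have h := (EuclideanSpace.basisFun κ ℂ).orthonormal
  have h2 := h.comp_linearIsometry U
  convert h2 using 2 with k
  simp

theorem conjTranspose_columns_mul {m κ : Type*} [Fintype m] {u : κ → EuclideanSpace ℂ m}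
    (hu : Orthonormal ℂ u) {ι ι' : Type*} (f : ι → κ) (g : ι' → κ) [DecidableEq κ] :
    (Matrix.of fun a k => u (f k) a : Matrix m ι ℂ)ᴴ * (Matrix.of fun a k => u (g k) a) =
      Matrix.of fun k l => if f k = g l then 1 else 0 := by
  ext k l
  rw [Matrix.of_apply, ← orthonormal_iff_ite.1 hu, PiLp.inner_apply, Matrix.mul_apply]
  simp [mul_comm]

/-- If the reduced state of the maximally mixed code state is proportional to a projection, then
the states of all sectors have flat spectrum. -/
theorem reduced_mul_self (V : E →ₗᵢ[ℂ] Hilb n G) {r : ℕ} {a b c d : Fin r → ℕ}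
    (B : OrthonormalBasis (Σ α : Fin r, Fin (a α) × Fin (b α)) ℂ E)
    (UA : EuclideanSpace ℂ (Σ α : Fin r, Fin (a α) × Fin (c α)) →ₗᵢ[ℂ] RegionHilb A G)
    (UB : EuclideanSpace ℂ (Σ α : Fin r, Fin (b α) × Fin (d α)) →ₗᵢ[ℂ] RegionHilb Aᶜ G)
    (χ : ∀ α, EuclideanSpace ℂ (Fin (c α) × Fin (d α)))
    (hB : ∀ α i j, V (B ⟨α, (i, j)⟩) =
      ∑ k, ∑ l, χ α (k, l) •
        prodVec A (UA (EuclideanSpace.single ⟨α, (i, k)⟩ 1))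
          (UB (EuclideanSpace.single ⟨α, (j, l)⟩ 1)))
    {lam : ℂ} {K : Matrix (A → G) (A → G) ℂ}
    (hK : K = ∑ p, coeffMatrix A (V (B p)) * (coeffMatrix A (V (B p)))ᴴ)
    (hKK : K * K = lam • K) (α : Fin r) (i : Fin (a α)) (j : Fin (b α)) :
    reduced (χ α) * reduced (χ α) = (lam / b α) • reduced (χ α) := by
  have hu := orthonormal_map_single UA
  have hv := orthonormal_map_single UB
  let Y : ∀ α, Fin (a α) → Matrix (A → G) (Fin (c α)) ℂ := fun α i =>
    Matrix.of fun x k => UA (EuclideanSpace.single ⟨α, (i, k)⟩ 1) x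
  let Z : ∀ α, Fin (b α) → Matrix (↥Aᶜ → G) (Fin (d α)) ℂ := fun α j =>
    Matrix.of fun x l => UB (EuclideanSpace.single ⟨α, (j, l)⟩ 1) x
  let M : ∀ α, Matrix (Fin (c α)) (Fin (d α)) ℂ := fun α => Matrix.of fun k l => χ α (k, l)
  have hYY : ∀ α i, (Y α i)ᴴ * Y α i = 1 := fun α i => by
    rw [conjTranspose_columns_mul hu (fun k => ⟨α, (i, k)⟩) fun k => ⟨α, (i, k)⟩]
    ext k l
    simp [Matrix.one_apply]
  have hYY0 : ∀ α i β i', (⟨α, i⟩ : Σ α, Fin (a α)) ≠ ⟨β, i'⟩ → (Y α i)ᴴ * Y β i' = 0 :=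
    fun α i β i' hne => by
      rw [conjTranspose_columns_mul hu (fun k => ⟨α, (i, k)⟩) fun k => ⟨β, (i', k)⟩]
      ext k l
      rw [Matrix.of_apply, if_neg, Matrix.zero_apply]
      intro heq
      apply hne
      rw [Sigma.mk.injEq] at heq
      obtain ⟨rfl, h2⟩ := heq
      rw [heq_eq_eq, Prod.mk.injEq] at h2
      rw [h2.1]
  have hZZ : ∀ α j, (Z α j)ᴴ * Z α j = 1 := fun α j => by
    rw [conjTranspose_columns_mul hv (fun k => ⟨α, (j, k)⟩) fun k => ⟨α, (j, k)⟩]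
    ext k l
    simp [Matrix.one_apply]
  have hX : ∀ α i j, coeffMatrix A (V (B ⟨α, (i, j)⟩)) = Y α i * M α * (Z α j)ᵀ := fun α i j => by
    rw [hB]
    ext x y
    simp only [map_sum, map_smul, coeffMatrix_prodVec, Matrix.sum_apply, Matrix.smul_apply,
      Matrix.vecMulVec_apply, smul_eq_mul]
    rw [Matrix.mul_apply, Finset.sum_comm]
    refine Finset.sum_congr rfl fun l _ => ?_
    rw [Matrix.mul_apply, Finset.sum_mul]
    refine Finset.sum_congr rfl fun k _ => ?_
    simp only [Y, Z, M, Matrix.transpose_apply, Matrix.of_apply]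
    ring
  have hXX : ∀ α i j, coeffMatrix A (V (B ⟨α, (i, j)⟩)) * (coeffMatrix A (V (B ⟨α, (i, j)⟩)))ᴴ =
      Y α i * reduced (χ α) * (Y α i)ᴴ := fun α i j => by
    have h1 : (Z α j)ᵀ * (Z α j)ᵀᴴ = 1 := by
      have := congrArg Matrix.transpose (hZZ α j)
      rwa [Matrix.transpose_mul, Matrix.transpose_one] at this
    rw [hX, reduced_eq_mul, conjTranspose_mul, conjTranspose_mul]
    calc Y α i * M α * (Z α j)ᵀ * ((Z α j)ᵀᴴ * ((M α)ᴴ * (Y α i)ᴴ))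
        = Y α i * M α * ((Z α j)ᵀ * (Z α j)ᵀᴴ) * (M α)ᴴ * (Y α i)ᴴ := by
          simp only [Matrix.mul_assoc]
      _ = Y α i * (M α * (M α)ᴴ) * (Y α i)ᴴ := by
          rw [h1, Matrix.mul_one]
          simp only [Matrix.mul_assoc]
  -- `hXX` does not depend on `j`, so the sum over `j` contributes the factor `b α`.
  have hK2 : K = ∑ p : Σ α, Fin (a α), (b p.1 : ℂ) • (Y p.1 p.2 * reduced (χ p.1) * (Y p.1 p.2)ᴴ) := by
    rw [hK, Fintype.sum_sigma, Fintype.sum_sigma]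
    refine Finset.sum_congr rfl fun α _ => ?_
    rw [Fintype.sum_prod_type]
    refine Finset.sum_congr rfl fun i _ => ?_
    simp only [hXX]
    simp [Nat.cast_smul_eq_nsmul]
  have hKY : K * Y α i = (b α : ℂ) • (Y α i * reduced (χ α)) := by
    rw [hK2, Matrix.sum_mul, Finset.sum_eq_single ⟨α, i⟩]
    · rw [Matrix.smul_mul, Matrix.mul_assoc _ _ (Y α i), hYY, Matrix.mul_one]
    · rintro ⟨β, i'⟩ _ hne
      rw [Matrix.smul_mul, Matrix.mul_assoc _ _ (Y α i), hYY0 _ _ _ _ hne, Matrix.mul_zero, smul_zero]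
    · simp
  have hb : (b α : ℂ) ≠ 0 := Nat.cast_ne_zero.2 (Fin.pos j).ne'
  -- Compressing `K² = λ K` to one block gives `b² ρ² = λ b ρ`.
  have h1 := congrArg (fun X => (Y α i)ᴴ * (X * Y α i)) hKK
  simp only [Matrix.smul_mul, Matrix.mul_assoc K K, hKY, Matrix.mul_smul] at h1
  rw [← Matrix.mul_assoc K, hKY, Matrix.smul_mul, Matrix.mul_smul, ← Matrix.mul_assoc,
    ← Matrix.mul_assoc, hYY, Matrix.one_mul, smul_smul, smul_smul] at h1
  have h2 := congrArg (fun X => ((b α : ℂ) * b α)⁻¹ • X) h1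
  simp only [smul_smul] at h2
  rw [inv_mul_cancel₀ (mul_ne_zero hb hb), one_smul] at h2
  rw [h2]
  congr 1
  field_simp

end Flat

/-! ### The reduced code projection of a stabilizer code -/

section FlatStabilizer

variable {n : ℕ} {A : Finset (Fin n)} {G : Type*} [Fintype G] [DecidableEq G] {Λ : Type*}
  [AddCommGroup Λ] [Fintype Λ]
  {E : Type*} [NormedAddCommGroup E] [InnerProductSpace ℂ E] [FiniteDimensional ℂ E]

theorem norm_toEuclideanLin_of_unitary {m : Type*} [Fintype m] [DecidableEq m] {U : Matrix m m ℂ}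
    (hU : Uᴴ * U = 1) (φ : EuclideanSpace ℂ m) : ‖toEuclideanLin U φ‖ = ‖φ‖ := by
  rw [@norm_eq_sqrt_re_inner ℂ, @norm_eq_sqrt_re_inner ℂ _ _ _ _ φ, ← inner_toEuclideanLin_left,
    ← toEuclideanLin_mul_apply, hU, toEuclideanLin, toLpLin_one, LinearMap.id_apply]

theorem toEuclideanLin_vecMulVec_star {m : Type*} [Fintype m] [DecidableEq m]
    (x φ : EuclideanSpace ℂ m) :
    toEuclideanLin (Matrix.vecMulVec x (star (x : m → ℂ))) φ = (inner ℂ x φ : ℂ) • x := by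
  ext i
  rw [toLpLin_apply, WithLp.ofLp_toLp, Matrix.mulVec, dotProduct, PiLp.smul_apply,
    PiLp.inner_apply, smul_eq_mul, Finset.sum_mul]
  refine Finset.sum_congr rfl fun j _ => ?_
  simp [Matrix.vecMulVec_apply]
  ring

namespace IsStabilizerEncoding

variable {𝒲 : WeylSystem A G Λ} {V : E →ₗᵢ[ℂ] Hilb n G} {S : AddSubgroup Λ} {z : Λ → ℂ}
  (h : IsStabilizerEncoding 𝒲 V S z)

include h

/-- The Weyl cocycle is absorbed by the phases: both sides are multiples of `W (s + t)` and fix a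
nonzero code vector. -/
theorem phase_mul [Nontrivial E] {s t : Λ} (hs : s ∈ S) (ht : t ∈ S) :
    (z s • 𝒲.W s) * (z t • 𝒲.W t) = z (s + t) • 𝒲.W (s + t) := by
  obtain ⟨c, -, hc⟩ := 𝒲.W_mul s t
  rw [smul_mul_smul_comm, hc, smul_smul]
  congr 1
  obtain ⟨ψ, hψ⟩ := exists_ne (0 : E)
  have hψ' : V ψ ≠ 0 := fun h0 => hψ (V.injective (by rw [h0, map_zero]))
  apply smul_left_injective ℂ hψ'
  have h1 := congrArg (fun X => toEuclideanLin X (V ψ)) hc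
  simp only [map_smul, LinearMap.smul_apply, toEuclideanLin_mul_apply, h.W_apply hs,
    h.W_apply ht, h.W_apply (add_mem hs ht), smul_smul] at h1
  have h2 := smul_left_injective ℂ hψ' h1
  have h3 := h.phase_ne_zero hs
  have h4 := h.phase_ne_zero ht
  have h5 := h.phase_ne_zero (add_mem hs ht)
  have h6 : z s * z t * c = z (s + t) := by
    field_simp at h2
    rw [h2]
    ring
  dsimp only
  rw [h6]

theorem norm_phase [Nontrivial E] {s : Λ} (hs : s ∈ S) : ‖z s‖ = 1 := by
  obtain ⟨ψ, hψ⟩ := exists_ne (0 : E)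
  have h1 := norm_toEuclideanLin_of_unitary (𝒲.conjTranspose_mul_W s) (V ψ)
  rw [h.W_apply hs, norm_smul, V.norm_map] at h1
  have h2 := mul_right_cancel₀ (norm_ne_zero_iff.2 hψ) (h1.trans (one_mul _).symm)
  rwa [norm_inv, inv_eq_one] at h2

theorem conjTranspose_W_apply [Nontrivial E] {s : Λ} (hs : s ∈ S) (ψ : E) :
    toEuclideanLin (z s • 𝒲.W s)ᴴ (V ψ) = V ψ := by
  nth_rewrite 1 [← h.fix s hs ψ]
  rw [conjTranspose_smul, map_smul, map_smul, LinearMap.smul_apply, ← toEuclideanLin_mul_apply,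
    𝒲.conjTranspose_mul_W, smul_smul, RCLike.star_def, Complex.mul_conj,
    Complex.normSq_eq_norm_sq, h.norm_phase hs]
  simp [toEuclideanLin]

/-- The projection onto the code is the average of the stabilizer. -/
theorem average_apply [Nontrivial E] [Fintype S] (φ : Hilb n G) :
    toEuclideanLin ((Fintype.card S : ℂ)⁻¹ • ∑ s : S, z s • 𝒲.W s) φ =
      V (LinearMap.adjoint V.toLinearMap φ) := by
  set P := (Fintype.card S : ℂ)⁻¹ • ∑ s : S, z s • 𝒲.W s with hP
  have hcard : (Fintype.card S : ℂ) ≠ 0 := Nat.cast_ne_zero.2 Fintype.card_ne_zero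
  -- Translation invariance of the average: its range consists of stabilized vectors, hence lies in
  -- the code.
  have hg : ∀ t ∈ S, (z t • 𝒲.W t) * P = P := fun t ht => by
    rw [hP, mul_smul_comm, Finset.mul_sum]
    congr 1
    refine Fintype.sum_equiv (Equiv.addLeft (⟨t, ht⟩ : S)) _ _ fun s => ?_
    rw [h.phase_mul ht s.2]
    rfl
  obtain ⟨η, hη⟩ := h.range (toEuclideanLin P φ) fun t ht => by
    have := congrArg (fun X => toEuclideanLin X φ) (hg t ht)
    simpa only [toEuclideanLin_mul_apply, map_smul, LinearMap.smul_apply] using this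
  rw [← hη]
  congr 1
  refine ext_inner_left ℂ fun ξ => ?_
  rw [LinearMap.adjoint_inner_right, LinearIsometry.coe_toLinearMap, ← V.inner_map_map, hη,
    ← inner_toEuclideanLin_left]
  congr 1
  rw [hP, conjTranspose_smul, conjTranspose_sum, map_smul, map_sum, LinearMap.smul_apply,
    LinearMap.sum_apply, Finset.sum_congr rfl fun s _ => h.conjTranspose_W_apply s.2 ξ]
  simp [← Nat.cast_smul_eq_nsmul ℂ, smul_smul, hcard]

theorem average_eq_sum [Nontrivial E] [Fintype S] {κ : Type*} [Fintype κ]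
    (B : OrthonormalBasis κ ℂ E) :
    (Fintype.card S : ℂ)⁻¹ • ∑ s : S, z s • 𝒲.W s =
      ∑ p, Matrix.vecMulVec (V (B p)) (star (V (B p) : (Fin n → G) → ℂ)) := by
  apply toEuclideanLin.injective
  ext1 φ
  rw [h.average_apply, ← B.sum_repr (LinearMap.adjoint V.toLinearMap φ), map_sum, map_sum,
    LinearMap.sum_apply]
  refine Finset.sum_congr rfl fun p _ => ?_
  rw [toEuclideanLin_vecMulVec_star, map_smul, B.repr_apply_apply, LinearMap.adjoint_inner_right]
  rfl

/-- The reduced state of the maximally mixed code state is proportional to a projection. -/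
theorem exists_partialTrace_mul_self [Nontrivial E] [Nonempty G] {κ : Type*} [Fintype κ]
    (B : OrthonormalBasis κ ℂ E) :
    ∃ lam : ℂ, (∑ p, coeffMatrix A (V (B p)) * (coeffMatrix A (V (B p)))ᴴ) *
      (∑ p, coeffMatrix A (V (B p)) * (coeffMatrix A (V (B p)))ᴴ) =
      lam • ∑ p, coeffMatrix A (V (B p)) * (coeffMatrix A (V (B p)))ᴴ := by
  classical
  have := Fintype.ofFinite S
  let H : AddSubgroup Λ := S ⊓ 𝒲.ΛA
  have := Fintype.ofFinite H
  -- A sum over a group represented on `A`, hence a multiple of a projection. The product rule is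
  -- checked on the whole space, where `phase_mul` is available, and pulled back by injectivity of
  -- `onRegion`.
  set F : Matrix (A → G) (A → G) ℂ := ∑ s : H, z s • 𝒲.WA s with hF
  have hFF : F * F = (Fintype.card H : ℂ) • F := by
    have h1 : ∀ s : H, (z s • 𝒲.WA s) * F = F := fun s => by
      rw [hF, Finset.mul_sum]
      refine Fintype.sum_equiv (Equiv.addLeft s) _ _ fun t => ?_
      apply onRegion_injective A
      have h2 := h.phase_mul s.2.1 t.2.1
      rw [onRegion_mul, onRegion_smul, onRegion_smul, onRegion_smul, 𝒲.onRegion_WA s.2.2,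
        𝒲.onRegion_WA t.2.2, h2]
      rw [Equiv.coe_addLeft, AddSubgroup.coe_add, 𝒲.onRegion_WA (add_mem s.2.2 t.2.2)]
    nth_rewrite 1 [hF]
    rw [Finset.sum_mul, Finset.sum_congr rfl fun s _ => h1 s]
    simp [Nat.cast_smul_eq_nsmul]
  -- Labels outside `ΛA` have a traceless factor on `Aᶜ` and drop out of the partial trace.
  have hK : ∑ p, coeffMatrix A (V (B p)) * (coeffMatrix A (V (B p)))ᴴ =
      ((Fintype.card S : ℂ)⁻¹ * (1 : Matrix (↥Aᶜ → G) (↥Aᶜ → G) ℂ).trace) • F := by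
    simp only [← partialTrace_vecMulVec]
    rw [← partialTrace_sum, ← h.average_eq_sum B, partialTrace_smul, partialTrace_sum, mul_smul]
    congr 1
    have h3 : ∀ s : S, partialTrace A (z s • 𝒲.W s) = if (s : Λ) ∈ 𝒲.ΛA then
        (1 : Matrix (↥Aᶜ → G) (↥Aᶜ → G) ℂ).trace • z s • 𝒲.WA s else 0 := fun s => by
      rw [partialTrace_smul, WeylSystem.W, partialTrace_loc]
      split_ifs with hs
      · rw [𝒲.WB_eq_one s hs, smul_comm]
      · rw [𝒲.trace_WB s hs, zero_smul, smul_zero]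
    rw [Finset.sum_congr rfl fun s _ => h3 s, hF, Finset.smul_sum, ← Finset.sum_filter]
    refine Finset.sum_bij' (fun s hs => (⟨s, s.2, (Finset.mem_filter.1 hs).2⟩ : H))
      (fun s _ => (⟨s, s.2.1⟩ : S)) ?_ ?_ ?_ ?_ ?_
    · intros; simp
    · intro s _
      simpa using s.2.2
    · intros; rfl
    · intros; rfl
    · intros; rfl
  refine ⟨(Fintype.card S : ℂ)⁻¹ * (1 : Matrix (↥Aᶜ → G) (↥Aᶜ → G) ℂ).trace * Fintype.card H, ?_⟩
  rw [hK, smul_mul_smul_comm, hFF, smul_smul, smul_smul]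
  congr 1
  ring

end IsStabilizerEncoding

end FlatStabilizer

/-! ### Equal multiplicities in all sectors -/

section SectorDimensions

variable {n : ℕ} {A : Finset (Fin n)} {G : Type*} [Fintype G] [DecidableEq G] {Λ : Type*}
  [AddCommGroup Λ] [Fintype Λ]
  {E : Type*} [NormedAddCommGroup E] [InnerProductSpace ℂ E] [FiniteDimensional ℂ E]

theorem trace_leftUnit {ι : Type*} [Fintype ι] {a b : ι → ℕ}
    (B : OrthonormalBasis (Σ α, Fin (a α) × Fin (b α)) ℂ E) (α : ι) (i : Fin (a α)) :
    LinearMap.trace ℂ E (leftUnit B α i i) = b α := by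
  have h : ∀ x : E, LinearMap.trace ℂ E (ketBra x x) = inner ℂ x x := fun x => by
    rw [ketBra, LinearMap.trace_smulRight]
    rfl
  simp [leftUnit, h, inner_self_eq_norm_sq_to_K]

namespace IsStabilizerEncoding

variable {𝒲 : WeylSystem A G Λ} {V : E →ₗᵢ[ℂ] Hilb n G} {S : AddSubgroup Λ} {z : Λ → ℂ}
  (h : IsStabilizerEncoding 𝒲 V S z)

include h

theorem star_logical_W_mul {w : Λ} (hw : w ∈ 𝒲.perp S) :
    star (logical V (𝒲.W w)) * logical V (𝒲.W w) = 1 := by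
  refine LinearMap.ext fun ψ => V.injective ?_
  obtain ⟨η, hη⟩ : ∃ η, η = logical V (𝒲.W w) ψ := ⟨_, rfl⟩
  rw [Module.End.mul_apply, star_logical, h.map_logical_W_conjTranspose hw, h.map_logical_W hw,
    ← toEuclideanLin_mul_apply, 𝒲.conjTranspose_mul_W, toEuclideanLin, toLpLin_one]
  rfl

theorem logical_W_mul {v w : Λ} (hv : v ∈ 𝒲.perp S) (hw : w ∈ 𝒲.perp S) : ∃ c : ℂ, ‖c‖ = 1 ∧
    logical V (𝒲.W v) * logical V (𝒲.W w) = c • logical V (𝒲.W (v + w)) := by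
  obtain ⟨c, hc1, hc⟩ := 𝒲.W_mul v w
  refine ⟨c, hc1, LinearMap.ext fun ψ => V.injective ?_⟩
  rw [Module.End.mul_apply, h.map_logical_W hv, h.map_logical_W hw, LinearMap.smul_apply, map_smul,
    h.map_logical_W (add_mem hv hw), ← toEuclideanLin_mul_apply, hc, map_smul]
  rfl

/-- As `W w` is a product across the cut, its factor on `Aᶜ` cancels in the conjugation, whether or
not `w` is supported on `A`. -/
theorem conj_mem_encodedAlgebra {w : Λ} (hw : w ∈ 𝒲.perp S) {T : Module.End ℂ E}
    (hT : T ∈ encodedAlgebra V A) :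
    logical V (𝒲.W w) * T * star (logical V (𝒲.W w)) ∈ encodedAlgebra V A := by
  obtain ⟨O, hO⟩ := mem_encodedAlgebra_iff.1 hT
  have key : ∀ O : Matrix (A → G) (A → G) ℂ,
      onRegion A (𝒲.WA w * O * (𝒲.WA w)ᴴ) = 𝒲.W w * onRegion A O * (𝒲.W w)ᴴ := fun O => by
    rw [WeylSystem.W, onRegion_eq_loc, onRegion_eq_loc, loc_conjTranspose, loc_mul_loc,
      loc_mul_loc, mul_one, 𝒲.WB_unitary]
  refine mem_encodedAlgebra_iff.2 ⟨𝒲.WA w * O * (𝒲.WA w)ᴴ, fun ψ => ?_⟩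
  have h1 : (𝒲.WA w * O * (𝒲.WA w)ᴴ)ᴴ = 𝒲.WA w * Oᴴ * (𝒲.WA w)ᴴ := by
    rw [conjTranspose_mul, conjTranspose_mul, conjTranspose_conjTranspose, mul_assoc]
  have h2 : star (logical V (𝒲.W w) * T * star (logical V (𝒲.W w))) =
      logical V (𝒲.W w) * star T * star (logical V (𝒲.W w)) := by
    rw [star_mul, star_mul, star_star, mul_assoc]
  rw [h1, h2, key, key]
  simp only [toEuclideanLin_mul_apply, Module.End.mul_apply]
  rw [star_logical, ← h.map_logical_W_conjTranspose hw, (hO _).1, (hO _).2, h.map_logical_W hw,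
    h.map_logical_W hw]
  exact ⟨rfl, rfl⟩

/-- Twirling: left translation of the labels shows that the sum commutes with every logical Weyl
operator, the phases cancelling against their conjugates; irreducibility then makes it scalar. -/
theorem exists_average_eq_smul [Nontrivial E] [Fintype (𝒲.perp S)] (T : Module.End ℂ E) :
    ∃ c : ℂ, ∑ w : 𝒲.perp S, logical V (𝒲.W w) * T * star (logical V (𝒲.W w)) = c • 1 := by
  obtain ⟨c, hc⟩ := h.eq_smul_of_commute
    (T := ∑ w : 𝒲.perp S, logical V (𝒲.W w) * T * star (logical V (𝒲.W w))) fun u hu ψ => by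
    simp only [← Module.End.mul_apply]
    congr 1
    set X := ∑ w : 𝒲.perp S, logical V (𝒲.W w) * T * star (logical V (𝒲.W w)) with hX
    have h1 : logical V (𝒲.W u) * X * star (logical V (𝒲.W u)) = X := by
      rw [hX, Finset.mul_sum, Finset.sum_mul]
      refine Fintype.sum_equiv (Equiv.addLeft (⟨u, hu⟩ : 𝒲.perp S)) _ _ fun w => ?_
      obtain ⟨c, hc1, hc⟩ := h.logical_W_mul hu w.2
      have h2 : logical V (𝒲.W u) * (logical V (𝒲.W w) * T * star (logical V (𝒲.W w))) *
          star (logical V (𝒲.W u)) = (logical V (𝒲.W u) * logical V (𝒲.W w)) * T *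
            star (logical V (𝒲.W u) * logical V (𝒲.W w)) := by
        rw [star_mul]
        simp only [mul_assoc]
      rw [h2, hc, star_smul, smul_mul_assoc, smul_mul_assoc, mul_smul_comm, smul_smul,
        RCLike.star_def, Complex.mul_conj, Complex.normSq_eq_norm_sq, hc1]
      simp
    calc logical V (𝒲.W u) * X =
        logical V (𝒲.W u) * X * (star (logical V (𝒲.W u)) * logical V (𝒲.W u)) := by
          rw [h.star_logical_W_mul hu, mul_one]
      _ = X * logical V (𝒲.W u) := by rw [← mul_assoc, h1]
  exact ⟨c, LinearMap.ext hc⟩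

/-- The multiplicity spaces of two sectors of the algebra of a region have the same dimension. -/
theorem multiplicity_le [Nontrivial E] {ι : Type*} [Fintype ι] {a b : ι → ℕ}
    (B : OrthonormalBasis (Σ α, Fin (a α) × Fin (b α)) ℂ E)
    (hB : ∀ T, T ∈ encodedAlgebra V A ↔ IsBlockOp B T) {α β : ι} (i : Fin (a α)) (j : Fin (b α))
    (i' : Fin (a β)) : b β ≤ b α := by
  classical
  rcases Nat.eq_zero_or_pos (b β) with h0 | hpos
  · simp [h0]
  let j' : Fin (b β) := ⟨0, hpos⟩
  have := Fintype.ofFinite (𝒲.perp S)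
  let T : Λ → Module.End ℂ E := fun w =>
    logical V (𝒲.W w) * leftUnit B α i i * star (logical V (𝒲.W w))
  obtain ⟨c, hc⟩ := h.exists_average_eq_smul (leftUnit B α i i)
  -- Each conjugate has the trace `b α ≠ 0` of the matrix unit, so the twirl cannot vanish.
  have hc0 : c ≠ 0 := by
    rintro rfl
    have h1 := congrArg (LinearMap.trace ℂ E) hc
    have h2 : ∀ w : 𝒲.perp S, LinearMap.trace ℂ E (T w) = b α := fun w => by
      rw [LinearMap.trace_mul_comm, ← mul_assoc, h.star_logical_W_mul w.2, one_mul,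
        trace_leftUnit]
    rw [map_sum, Finset.sum_congr rfl fun w _ => h2 w, zero_smul, map_zero] at h1
    have h3 : b α ≠ 0 := (j.pos).ne'
    simp [h3] at h1
  -- A nonzero scalar kills no vector, so some conjugate reaches sector `β`.
  obtain ⟨w, hw⟩ : ∃ w : 𝒲.perp S, T w (B ⟨β, (i', j')⟩) ≠ 0 := by
    by_contra! h1
    have h2 := LinearMap.congr_fun hc (B ⟨β, (i', j')⟩)
    rw [LinearMap.sum_apply, Finset.sum_eq_zero fun w _ => h1 w] at h2
    refine B.orthonormal.ne_zero ⟨β, (i', j')⟩ ((smul_eq_zero.1 h2.symm).resolve_left hc0)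
  obtain ⟨O, hO⟩ := (hB _).1 (h.conj_mem_encodedAlgebra w.2 ((hB _).2 (isBlockOp_leftUnit B α i i)))
  obtain ⟨k, hk⟩ : ∃ k, O β k i' ≠ 0 := by
    by_contra! h1
    apply hw
    rw [hO]
    simp [h1]
  -- The conjugate is again in the algebra, so on sector `β` it has the form `O ⊗ 1`; a nonzero
  -- entry of `O` keeps all `b β` multiplicity vectors independent.
  have hind : LinearIndependent ℂ fun l => T w (B ⟨β, (i', l)⟩) := by
    rw [Fintype.linearIndependent_iff]
    intro g hg l
    have h1 := congrArg (fun x => (inner ℂ (B ⟨β, (k, l)⟩) x : ℂ)) hg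
    simp only [T, hO, inner_sum, inner_smul_right, inner_zero_right,
      orthonormal_iff_ite.1 B.orthonormal] at h1
    simpa [Prod.ext_iff, ite_and, hk] using h1
  -- Yet its range is spanned by `b α` vectors, like that of the matrix unit it is conjugate to.
  have hspan : Submodule.span ℂ (Set.range fun l => T w (B ⟨β, (i', l)⟩)) ≤
      Submodule.span ℂ (Set.range fun l => logical V (𝒲.W w) (B ⟨α, (i, l)⟩)) := by
    rw [Submodule.span_le]
    rintro _ ⟨l, rfl⟩
    simp only [T, Module.End.mul_apply, leftUnit, LinearMap.sum_apply, ketBra_apply, map_sum,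
      map_smul]
    exact Submodule.sum_mem _ fun l _ => Submodule.smul_mem _ _
      (Submodule.subset_span ⟨l, rfl⟩)
  calc b β = Module.finrank ℂ (Submodule.span ℂ (Set.range fun l => T w (B ⟨β, (i', l)⟩))) := by
        rw [finrank_span_eq_card hind, Fintype.card_fin]
    _ ≤ _ := Submodule.finrank_mono hspan
    _ ≤ b α := (finrank_range_le_card _).trans_eq (Fintype.card_fin _)

/-- The sector states of a stabilizer code all have the same entropy. -/
theorem entropy_eq [Nontrivial E] [Nonempty G] {r : ℕ} {a b c d : Fin r → ℕ}
    (B : OrthonormalBasis (Σ α : Fin r, Fin (a α) × Fin (b α)) ℂ E)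
    (hB : ∀ T, T ∈ encodedAlgebra V A ↔ IsBlockOp B T)
    (UA : EuclideanSpace ℂ (Σ α : Fin r, Fin (a α) × Fin (c α)) →ₗᵢ[ℂ] RegionHilb A G)
    (UB : EuclideanSpace ℂ (Σ α : Fin r, Fin (b α) × Fin (d α)) →ₗᵢ[ℂ] RegionHilb Aᶜ G)
    (χ : ∀ α, EuclideanSpace ℂ (Fin (c α) × Fin (d α))) (hχ : ∀ α, ‖χ α‖ = 1)
    (hVB : ∀ α i j, V (B ⟨α, (i, j)⟩) = ∑ k, ∑ l, χ α (k, l) •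
        prodVec A (UA (EuclideanSpace.single ⟨α, (i, k)⟩ 1))
          (UB (EuclideanSpace.single ⟨α, (j, l)⟩ 1)))
    {α β : Fin r} (i : Fin (a α)) (j : Fin (b α)) (i' : Fin (a β)) (j' : Fin (b β)) :
    entropy (χ α) = entropy (χ β) := by
  obtain ⟨lam, hlam⟩ := h.exists_partialTrace_mul_self B
  rw [entropy_eq_of_mul_self (hχ α) (reduced_mul_self V B UA UB χ hVB rfl hlam α i j),
    entropy_eq_of_mul_self (hχ β) (reduced_mul_self V B UA UB χ hVB rfl hlam β i' j'),
    (h.multiplicity_le B hB i j i').antisymm (h.multiplicity_le B hB i' j' i)]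

end IsStabilizerEncoding

end SectorDimensions

/-! ### Pauli operators: products, traces, commutation, spanning -/

section RegionPauli

variable {ι : Type*} [Fintype ι] [DecidableEq ι] {G : Type*} [AddCommGroup G] [Fintype G]
  [DecidableEq G]

/-- The Pauli operator `⊗ᵢ X(aᵢ) Z(χᵢ)` on qudits labelled by `ι`. -/
noncomputable def regionPauli (a : ι → G) (χ : ι → AddChar G ℂ) : Matrix (ι → G) (ι → G) ℂ :=
  Matrix.of fun x y => ∏ i, if x i = y i + a i then χ i (y i) else 0

variable (a b : ι → G) (χ ψ : ι → AddChar G ℂ)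

theorem regionPauli_apply (x y : ι → G) :
    regionPauli a χ x y = if x = y + a then ∏ i, χ i (y i) else 0 := by
  rw [regionPauli, Matrix.of_apply, Finset.prod_ite_zero]
  simp [funext_iff]

theorem regionPauli_zero : regionPauli (0 : ι → G) 0 = 1 := by
  ext x y
  simp [regionPauli_apply, Matrix.one_apply]

theorem regionPauli_mul : regionPauli a χ * regionPauli b ψ =
    (∏ i, χ i (b i)) • regionPauli (a + b) (χ + ψ) := by
  ext x y
  simp only [Matrix.mul_apply, Matrix.smul_apply, regionPauli_apply, mul_ite, mul_zero, smul_eq_mul]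
  rw [Finset.sum_eq_single (y + b) (fun k _ hk => if_neg hk) (by simp), if_pos rfl, ite_mul,
    zero_mul]
  have h : y + b + a = y + (a + b) := by abel
  rw [h]
  congr 1
  simp only [← Finset.prod_mul_distrib, Pi.add_apply, AddChar.map_add_eq_mul, AddChar.add_apply]
  refine Finset.prod_congr rfl fun i _ => ?_
  ring

theorem norm_prod_addChar (y : ι → G) : ‖∏ i, χ i (y i)‖ = 1 := by
  simp [norm_prod]

theorem regionPauli_mul_conjTranspose : regionPauli a χ * (regionPauli a χ)ᴴ = 1 := by
  ext x y
  simp only [Matrix.mul_apply, Matrix.conjTranspose_apply, regionPauli_apply, Matrix.one_apply]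
  rw [Finset.sum_eq_single (x - a) (fun k _ hk => by
    rw [if_neg fun h => hk (eq_sub_of_add_eq h.symm), zero_mul]) (by simp)]
  rw [if_pos (sub_add_cancel x a).symm, sub_add_cancel]
  by_cases hxy : x = y
  · rw [if_pos hxy, if_pos hxy.symm, RCLike.star_def, Complex.mul_conj,
      Complex.normSq_eq_norm_sq, norm_prod_addChar]
    simp
  · rw [if_neg hxy, if_neg (Ne.symm hxy), star_zero, mul_zero]

/-- A nonzero shift has no diagonal entries; without a shift the trace is a product of character
sums, one of which vanishes. -/
theorem trace_regionPauli (h : ¬(a = 0 ∧ χ = 0)) : (regionPauli a χ).trace = 0 := by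
  simp only [Matrix.trace, Matrix.diag_apply, regionPauli_apply, left_eq_add]
  by_cases ha : a = 0
  · obtain ⟨i, hi⟩ := Function.ne_iff.1 fun hχ => h ⟨ha, hχ⟩
    simp only [ha, if_true]
    rw [← Fintype.prod_sum fun i g => χ i g]
    refine Finset.prod_eq_zero (Finset.mem_univ i) ?_
    classical
    rw [AddChar.sum_eq_ite]
    exact if_neg hi
  · simp [ha]

/-- The commutation phases of the Pauli operators. -/
noncomputable def pauliForm : ((ι → G) × (ι → AddChar G ℂ)) →+
    AddChar ((ι → G) × (ι → AddChar G ℂ)) ℂ where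
  toFun v :=
    { toFun w := ∏ i, v.2 i (w.1 i) * w.2 i (-v.1 i)
      map_zero_eq_one' := by simp
      map_add_eq_mul' w w' := by
        rw [← Finset.prod_mul_distrib]
        refine Finset.prod_congr rfl fun i _ => ?_
        simp only [Prod.fst_add, Prod.snd_add, Pi.add_apply, AddChar.map_add_eq_mul,
          AddChar.add_apply]
        ring }
  map_zero' := by
    ext w
    simp
  map_add' v v' := by
    ext w
    simp only [AddChar.coe_mk, AddChar.add_apply]
    rw [← Finset.prod_mul_distrib]
    refine Finset.prod_congr rfl fun i _ => ?_
    simp only [Prod.fst_add, Prod.snd_add, Pi.add_apply, neg_add, AddChar.map_add_eq_mul,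
      AddChar.add_apply]
    ring

theorem pauliForm_apply (v w : (ι → G) × (ι → AddChar G ℂ)) :
    pauliForm v w = ∏ i, v.2 i (w.1 i) * w.2 i (-v.1 i) := rfl

theorem pauliForm_mul_prod (v w : (ι → G) × (ι → AddChar G ℂ)) :
    pauliForm v w * ∏ i, w.2 i (v.1 i) = ∏ i, v.2 i (w.1 i) := by
  rw [pauliForm_apply, ← Finset.prod_mul_distrib]
  refine Finset.prod_congr rfl fun i _ => ?_
  rw [mul_assoc, ← AddChar.map_add_eq_mul, neg_add_cancel, AddChar.map_zero_eq_one, mul_one]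

theorem pauliForm_mul_swap (v w : (ι → G) × (ι → AddChar G ℂ)) :
    pauliForm v w * pauliForm w v = 1 := by
  have h : ∀ χ : ι → AddChar G ℂ, ∀ y : ι → G, ∏ i, χ i (y i) ≠ 0 := fun χ y =>
    norm_ne_zero_iff.1 (by rw [norm_prod_addChar]; exact one_ne_zero)
  have h1 := pauliForm_mul_prod v w
  have h2 := pauliForm_mul_prod w v
  refine mul_right_cancel₀ (h v.2 w.1) ?_
  rw [mul_assoc, h2, h1, one_mul]

/-- Single-qudit labels suffice as tests: pure `Z` labels detect the shift, since characters
separate points of `G`, and pure `X` labels detect the character. -/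
theorem pauliForm_injective : Function.Injective
    (pauliForm : ((ι → G) × (ι → AddChar G ℂ)) →+ _) := by
  rw [injective_iff_map_eq_zero]
  rintro ⟨a, χ⟩ h
  refine Prod.ext (funext fun i => ?_) (funext fun i => ?_)
  · by_contra ha
    obtain ⟨ψ, hψ⟩ := AddChar.exists_apply_ne_zero.2 (neg_ne_zero.2 ha)
    refine hψ ?_
    have h1 := DFunLike.congr_fun h (0, Pi.single i ψ)
    rw [pauliForm_apply, Finset.prod_eq_single i (fun j _ hj => by simp [hj]) (by simp)] at h1
    simpa using h1
  · ext g
    have h1 := DFunLike.congr_fun h (Pi.single i g, 0)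
    rw [pauliForm_apply, Finset.prod_eq_single i (fun j _ hj => by simp [hj]) (by simp)] at h1
    simpa using h1

theorem regionPauli_comm (v w : (ι → G) × (ι → AddChar G ℂ)) :
    regionPauli v.1 v.2 * regionPauli w.1 w.2 =
      pauliForm v w • (regionPauli w.1 w.2 * regionPauli v.1 v.2) := by
  rw [regionPauli_mul, regionPauli_mul, smul_smul, pauliForm_mul_prod, add_comm v.1, add_comm v.2]

/-- The Pauli operators span all operators. -/
theorem exists_eq_sum_regionPauli (X : Matrix (ι → G) (ι → G) ℂ) :
    ∃ t : (ι → G) × (ι → AddChar G ℂ) → ℂ, X = ∑ v, t v • regionPauli v.1 v.2 := by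
  classical
  let N : ℂ := ∏ _i : ι, (Fintype.card G : ℂ)
  have hN : N ≠ 0 := Finset.prod_ne_zero_iff.2 fun _ _ => Nat.cast_ne_zero.2 Fintype.card_ne_zero
  have key : ∀ y : ι → G, ∑ χ : ι → AddChar G ℂ, ∏ i, χ i (y i) = if y = 0 then N else 0 := by
    intro y
    rw [← Fintype.prod_sum fun i (χ : AddChar G ℂ) => χ (y i)]
    simp only [AddChar.sum_apply_eq_ite, Finset.prod_ite_zero]
    simp [funext_iff, N]
  -- Fourier coefficients along the diagonal with shift `v.1`; `key` is the orthogonality relation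
  -- that inverts them.
  refine ⟨fun v => N⁻¹ * ∑ y, X (y + v.1) y * ∏ i, v.2 i (-y i), ?_⟩
  ext x y
  simp only [Matrix.sum_apply, Matrix.smul_apply, regionPauli_apply, smul_eq_mul,
    Fintype.sum_prod_type]
  rw [Finset.sum_eq_single (x - y) (fun a _ ha => Finset.sum_eq_zero fun χ _ => by
    rw [if_neg fun h => ha (eq_sub_of_add_eq' h.symm), mul_zero]) (by simp)]
  simp only [add_sub_cancel, if_true]
  have h1 : ∀ χ : ι → AddChar G ℂ,
      (N⁻¹ * ∑ y', X (y' + (x - y)) y' * ∏ i, χ i (-y' i)) * ∏ i, χ i (y i) =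
        ∑ y', N⁻¹ * X (y' + (x - y)) y' * ∏ i, χ i ((y - y') i) := fun χ => by
    rw [Finset.mul_sum, Finset.sum_mul]
    refine Finset.sum_congr rfl fun y' _ => ?_
    have h2 : ∏ i, χ i ((y - y') i) = (∏ i, χ i (-y' i)) * ∏ i, χ i (y i) := by
      rw [← Finset.prod_mul_distrib]
      refine Finset.prod_congr rfl fun i _ => ?_
      rw [← AddChar.map_add_eq_mul, Pi.sub_apply, neg_add_eq_sub]
    rw [h2]
    ring
  rw [Finset.sum_congr rfl fun χ _ => h1 χ, Finset.sum_comm]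
  simp only [← Finset.mul_sum, key, sub_eq_zero, mul_ite, mul_zero, Finset.sum_ite_eq,
    Finset.mem_univ, if_true]
  rw [add_sub_cancel, mul_right_comm, inv_mul_cancel₀ hN, one_mul]

end RegionPauli

/-! ### The Pauli operators form a Weyl system -/

section PauliSystem

variable {n : ℕ} {G : Type*} [AddCommGroup G] [Fintype G] [DecidableEq G]

theorem loc_regionPauli (A : Finset (Fin n)) (a : Fin n → G) (χ : Fin n → AddChar G ℂ) :
    loc A (regionPauli (fun i => a i) fun i => χ i) (regionPauli (fun i => a i) fun i => χ i) =
      pauli a χ := by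
  ext x y
  let f : Fin n → ℂ := fun i => if x i = y i + a i then χ i (y i) else 0
  change (∏ i : A, f i) * (∏ i : ↥Aᶜ, f i) = ∏ i, f i
  rw [Finset.prod_coe_sort, Finset.prod_coe_sort, Finset.prod_mul_prod_compl]

/-- The labels of the Pauli operators supported on `A`. -/
def supportedOn (A : Finset (Fin n)) (G : Type*) [AddCommGroup G] :
    AddSubgroup ((Fin n → G) × (Fin n → AddChar G ℂ)) where
  carrier := {v | ∀ i ∉ A, v.1 i = 0 ∧ v.2 i = 0}
  zero_mem' := by simp
  add_mem' hv hw i hi := by simp [hv i hi, hw i hi]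
  neg_mem' hv i hi := by simp [hv i hi]

/-- The Pauli operators, as products of operators on `A` and on `Aᶜ`. -/
noncomputable def pauliSystem (A : Finset (Fin n)) (G : Type*) [AddCommGroup G] [Fintype G]
    [DecidableEq G] : WeylSystem A G ((Fin n → G) × (Fin n → AddChar G ℂ)) where
  WA v := regionPauli (fun i => v.1 i) fun i => v.2 i
  WB v := regionPauli (fun i => v.1 i) fun i => v.2 i
  ΛA := supportedOn A G
  ΛB := supportedOn Aᶜ G
  form := pauliForm
  form_injective := pauliForm_injective
  form_mul_swap := pauliForm_mul_swap
  form_eq_one v hv w hw := by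
    rw [pauliForm_apply]
    refine Finset.prod_eq_one fun i _ => ?_
    by_cases hi : i ∈ A
    · have := hw i (by simpa using hi)
      simp [this]
    · have := hv i hi
      simp [this]
  sup_eq_top := by
    rw [eq_top_iff]
    rintro ⟨a, χ⟩ -
    refine AddSubgroup.mem_sup.2 ⟨(fun i => if i ∈ A then a i else 0,
      fun i => if i ∈ A then χ i else 0), fun i hi => by simp [hi],
      (fun i => if i ∈ A then 0 else a i, fun i => if i ∈ A then 0 else χ i),
      fun i hi => by simp_all, ?_⟩
    refine Prod.ext (funext fun i => ?_) (funext fun i => ?_) <;>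
      by_cases hi : i ∈ A <;> simp [hi]
  WA_eq_one v hv := by
    have h1 : (fun i : A => v.1 i) = 0 := funext fun i => (hv i (by simp)).1
    have h2 : (fun i : A => v.2 i) = 0 := funext fun i => (hv i (by simp)).2
    rw [h1, h2, regionPauli_zero]
  WB_eq_one v hv := by
    have h1 : (fun i : ↥Aᶜ => v.1 i) = 0 := funext fun i => (hv i (Finset.mem_compl.1 i.2)).1
    have h2 : (fun i : ↥Aᶜ => v.2 i) = 0 := funext fun i => (hv i (Finset.mem_compl.1 i.2)).2
    rw [h1, h2, regionPauli_zero]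
  trace_WB v hv := by
    refine trace_regionPauli _ _ fun h => hv fun i hi => ?_
    exact ⟨congrFun h.1 ⟨i, Finset.mem_compl.2 hi⟩, congrFun h.2 ⟨i, Finset.mem_compl.2 hi⟩⟩
  WA_unitary v := regionPauli_mul_conjTranspose _ _
  WB_unitary v := regionPauli_mul_conjTranspose _ _
  mul v w := by
    refine ⟨_, norm_prod_addChar v.2 w.1, ?_⟩
    rw [loc_regionPauli, loc_regionPauli, loc_regionPauli]
    exact regionPauli_mul _ _ _ _
  comm v w := by
    rw [loc_regionPauli, loc_regionPauli]
    exact regionPauli_comm v w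
  span X := by
    simp only [loc_regionPauli]
    exact exists_eq_sum_regionPauli X

theorem pauliSystem_W (A : Finset (Fin n)) (v : (Fin n → G) × (Fin n → AddChar G ℂ)) :
    (pauliSystem A G).W v = pauli v.1 v.2 := loc_regionPauli A v.1 v.2

end PauliSystem

/-! ### Conjugation by a product unitary -/

section Conjugate

variable {n : ℕ} {A : Finset (Fin n)} {G : Type*} [Fintype G] [DecidableEq G] {Λ : Type*}
  [AddCommGroup Λ] [Fintype Λ]

theorem conj_mul_conj {m : Type*} [Fintype m] [DecidableEq m] {U : Matrix m m ℂ}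
    (hU : U * Uᴴ = 1) (X Y : Matrix m m ℂ) : Uᴴ * X * U * (Uᴴ * Y * U) = Uᴴ * (X * Y) * U := by
  simp only [mul_assoc]
  rw [← mul_assoc U, hU, one_mul]

/-- The Weyl system obtained by conjugating with the unitary `UA ⊗ UB`. -/
def WeylSystem.conjugate (𝒲 : WeylSystem A G Λ) {UA : Matrix (A → G) (A → G) ℂ}
    {UB : Matrix (↥Aᶜ → G) (↥Aᶜ → G) ℂ} (hUA : UA * UAᴴ = 1) (hUB : UB * UBᴴ = 1) :
    WeylSystem A G Λ where
  WA v := UAᴴ * 𝒲.WA v * UA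
  WB v := UBᴴ * 𝒲.WB v * UB
  ΛA := 𝒲.ΛA
  ΛB := 𝒲.ΛB
  form := 𝒲.form
  form_injective := 𝒲.form_injective
  form_mul_swap := 𝒲.form_mul_swap
  form_eq_one := 𝒲.form_eq_one
  sup_eq_top := 𝒲.sup_eq_top
  WA_eq_one v hv := by rw [𝒲.WA_eq_one v hv, mul_one, mul_eq_one_comm.1 hUA]
  WB_eq_one v hv := by rw [𝒲.WB_eq_one v hv, mul_one, mul_eq_one_comm.1 hUB]
  trace_WB v hv := by rw [Matrix.trace_mul_cycle, hUB, one_mul, 𝒲.trace_WB v hv]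
  WA_unitary v := by
    rw [conjTranspose_mul, conjTranspose_mul, conjTranspose_conjTranspose, ← mul_assoc UAᴴ,
      conj_mul_conj hUA, 𝒲.WA_unitary, mul_one, mul_eq_one_comm.1 hUA]
  WB_unitary v := by
    rw [conjTranspose_mul, conjTranspose_mul, conjTranspose_conjTranspose, ← mul_assoc UBᴴ,
      conj_mul_conj hUB, 𝒲.WB_unitary, mul_one, mul_eq_one_comm.1 hUB]
  mul v w := by
    obtain ⟨c, hc, h⟩ := 𝒲.mul v w
    refine ⟨c, hc, ?_⟩
    rw [loc_mul_loc, conj_mul_conj hUA, conj_mul_conj hUB, ← loc_mul_loc, ← loc_mul_loc,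
      ← loc_mul_loc, h, mul_smul_comm, smul_mul_assoc, loc_mul_loc, loc_mul_loc]
  comm v w := by
    have h := 𝒲.comm v w
    rw [loc_mul_loc, loc_mul_loc] at *
    rw [conj_mul_conj hUA, conj_mul_conj hUB, conj_mul_conj hUA, conj_mul_conj hUB,
      ← loc_mul_loc, ← loc_mul_loc, h, mul_smul_comm, smul_mul_assoc, loc_mul_loc, loc_mul_loc]
  span X := by
    obtain ⟨t, ht⟩ := 𝒲.span (loc A UA UB * X * (loc A UA UB)ᴴ)
    refine ⟨t, ?_⟩
    have hU : (loc A UA UB)ᴴ * loc A UA UB = 1 := by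
      rw [loc_conjTranspose, loc_mul_loc, mul_eq_one_comm.1 hUA, mul_eq_one_comm.1 hUB,
        loc_one_one]
    calc X = (loc A UA UB)ᴴ * (loc A UA UB * X * (loc A UA UB)ᴴ) * loc A UA UB := by
          rw [mul_assoc (loc A UA UB), ← mul_assoc, hU, one_mul, mul_assoc, hU, mul_one]
      _ = _ := by
          rw [ht, Finset.mul_sum, Finset.sum_mul]
          refine Finset.sum_congr rfl fun v _ => ?_
          rw [mul_smul_comm, smul_mul_assoc, loc_conjTranspose, loc_mul_loc, loc_mul_loc]

theorem WeylSystem.conjugate_W (𝒲 : WeylSystem A G Λ) {UA : Matrix (A → G) (A → G) ℂ}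
    {UB : Matrix (↥Aᶜ → G) (↥Aᶜ → G) ℂ} (hUA : UA * UAᴴ = 1) (hUB : UB * UBᴴ = 1) (v : Λ) :
    (𝒲.conjugate hUA hUB).W v = (loc A UA UB)ᴴ * 𝒲.W v * loc A UA UB := by
  rw [WeylSystem.W, WeylSystem.W, loc_conjTranspose, loc_mul_loc, loc_mul_loc]
  rfl

end Conjugate

/-! ### Splitting the block unitary along `A` -/

section Blocks

variable {n : ℕ} {G : Type*} [Fintype G] [DecidableEq G]

/-- A label on a disjoint union of regions as a pair of labels. -/
noncomputable def unionEquiv {A B D : Finset (Fin n)} (hAB : Disjoint A B) (hD : D = A ∪ B)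
    (G : Type*) : (D → G) ≃ (A → G) × (B → G) :=
  Equiv.ofBijective (fun x => (fun i => x ⟨i, hD ▸ Finset.mem_union_left B i.2⟩,
    fun i => x ⟨i, hD ▸ Finset.mem_union_right A i.2⟩)) <| by
  subst hD
  constructor
  · intro x y hxy
    rw [Prod.ext_iff] at hxy
    ext ⟨i, hi⟩
    rcases Finset.mem_union.1 hi with h | h
    · exact congrFun hxy.1 ⟨i, h⟩
    · exact congrFun hxy.2 ⟨i, h⟩
  · rintro ⟨x, y⟩
    refine ⟨fun i => if h : (i : Fin n) ∈ A then x ⟨i, h⟩ else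
      y ⟨i, (Finset.mem_union.1 i.2).resolve_left h⟩, Prod.ext (funext fun i => ?_)
      (funext fun i => ?_)⟩
    · simp
    · have : (i : Fin n) ∉ A := fun h => Finset.disjoint_left.1 hAB h i.2
      simp [this]

/-- A product of unitaries on disjoint blocks is a unitary on their union. -/
theorem exists_unitary_prod (U : ∀ B : Finset (Fin n), Matrix (B → G) (B → G) ℂ)
    (P : Finset (Finset (Fin n))) (hP : (P : Set (Finset (Fin n))).PairwiseDisjoint id)
    (hU : ∀ B ∈ P, U B * (U B)ᴴ = 1) (A : Finset (Fin n)) (hA : A = P.biUnion id) :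
    ∃ W : Matrix (A → G) (A → G) ℂ, W * Wᴴ = 1 ∧
      ∀ x y : Fin n → G, W (res A x) (res A y) = ∏ B ∈ P, U B (res B x) (res B y) := by
  classical
  induction P using Finset.induction_on generalizing A with
  | empty =>
    subst hA
    refine ⟨1, by rw [conjTranspose_one, mul_one], fun x y => ?_⟩
    have : res (Finset.biUnion ∅ id) x = res (Finset.biUnion ∅ id) y := by
      ext ⟨i, hi⟩
      simp at hi
    rw [this, Matrix.one_apply_eq, Finset.prod_empty]
  | insert B P hB ih =>
    obtain ⟨W, hW, hW'⟩ := ih (hP.subset (by simp)) (fun B' hB' => hU B' (by simp [hB'])) _ rfl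
    have hdisj : Disjoint B (P.biUnion id) := by
      rw [Finset.disjoint_biUnion_right]
      intro B' hB'
      exact hP (by simp) (by simp [hB']) fun h => hB (h ▸ hB')
    let e := unionEquiv hdisj (hA.trans (by simp)) G
    refine ⟨(U B ⊗ₖ W).submatrix e e, ?_, fun x y => ?_⟩
    · rw [conjTranspose_submatrix, Matrix.submatrix_mul_equiv, conjTranspose_kronecker,
        ← Matrix.mul_kronecker_mul, hW, hU B (by simp), Matrix.one_kronecker_one,
        Matrix.submatrix_one_equiv]
    · rw [Finset.prod_insert hB, ← hW']
      rfl

/-- The blocks in `KA` fill `A`, and since blocks are disjoint and cover all qudits, the remaining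
ones fill exactly `Aᶜ`. This is where `A` must be a union of blocks. -/
theorem exists_tensorOver_eq_loc (K : Finpartition (Finset.univ : Finset (Fin n)))
    (U : ∀ B : Finset (Fin n), Matrix (B → G) (B → G) ℂ)
    (hU : ∀ B ∈ K.parts, U B * (U B)ᴴ = 1) {KA : Finset (Finset (Fin n))} (hKA : KA ⊆ K.parts)
    {A : Finset (Fin n)} (hA : A = KA.biUnion id) :
    ∃ (UA : Matrix (A → G) (A → G) ℂ) (UB : Matrix (↥Aᶜ → G) (↥Aᶜ → G) ℂ),
      UA * UAᴴ = 1 ∧ UB * UBᴴ = 1 ∧ tensorOver K U = loc A UA UB := by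
  obtain ⟨UA, hUA, hUA'⟩ := exists_unitary_prod U KA (K.disjoint.subset (by simpa using hKA))
    (fun B hB => hU B (hKA hB)) A hA
  have hAc : Aᶜ = (K.parts \ KA).biUnion id := by
    ext i
    rw [hA]
    simp only [Finset.mem_compl, Finset.mem_biUnion, id, not_exists, not_and, Finset.mem_sdiff]
    constructor
    · intro h
      obtain ⟨B, hB, hi⟩ := K.exists_mem (Finset.mem_univ i)
      exact ⟨B, ⟨hB, fun hB' => h B hB' hi⟩, hi⟩
    · rintro ⟨B, ⟨hB, hB'⟩, hi⟩ B' hB'' hi'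
      exact hB' (K.eq_of_mem_parts hB (hKA hB'') hi hi' ▸ hB'')
  obtain ⟨UB, hUB, hUB'⟩ := exists_unitary_prod U (K.parts \ KA)
    (K.disjoint.subset (by simp)) (fun B hB => hU B (Finset.mem_sdiff.1 hB).1)
    Aᶜ hAc
  refine ⟨UA, UB, hUA, hUB, ?_⟩
  ext x y
  rw [loc_apply, hUA', hUB', mul_comm, Finset.prod_sdiff hKA]
  rfl

end Blocks

/-! ### From eigenvalue equations to a stabilizer encoding -/

section ExistsEncoding

variable {n : ℕ} {A : Finset (Fin n)} {G : Type*} [Fintype G] [DecidableEq G] {Λ : Type*}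
  [AddCommGroup Λ] [Fintype Λ]
  {E : Type*} [NormedAddCommGroup E] [InnerProductSpace ℂ E] [FiniteDimensional ℂ E]

/-- The labels of the Weyl operators that act on the encoded space as scalars. -/
def scalarLabels (𝒲 : WeylSystem A G Λ) (V : E →ₗᵢ[ℂ] Hilb n G) : AddSubgroup Λ where
  carrier := {v | ∃ k : ℂ, ∀ ψ, toEuclideanLin (𝒲.W v) (V ψ) = k • V ψ}
  zero_mem' := by
    obtain ⟨c, hc⟩ := 𝒲.W_zero
    refine ⟨c, fun ψ => ?_⟩
    rw [hc, map_smul, LinearMap.smul_apply, toEuclideanLin, toLpLin_one]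
    rfl
  add_mem' {v w} := by
    rintro ⟨k, hk⟩ ⟨l, hl⟩
    obtain ⟨c, hc1, hc⟩ := 𝒲.W_mul v w
    have hc0 : c ≠ 0 := norm_ne_zero_iff.1 (by rw [hc1]; exact one_ne_zero)
    have h : 𝒲.W (v + w) = c⁻¹ • (𝒲.W v * 𝒲.W w) := by
      rw [hc, smul_smul, inv_mul_cancel₀ hc0, one_smul]
    refine ⟨c⁻¹ * (l * k), fun ψ => ?_⟩
    rw [h, map_smul, LinearMap.smul_apply, toEuclideanLin_mul_apply, hl, map_smul, hk, smul_smul l,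
      smul_smul]
  neg_mem' {v} := by
    rintro ⟨k, hk⟩
    obtain ⟨c, hc⟩ := 𝒲.W_neg v
    refine ⟨c * k⁻¹, fun ψ => ?_⟩
    have h1 : k • toEuclideanLin (𝒲.W v)ᴴ (V ψ) = V ψ := by
      rw [← map_smul, ← hk, ← toEuclideanLin_mul_apply, 𝒲.conjTranspose_mul_W, toEuclideanLin,
        toLpLin_one]
      rfl
    rw [hc, map_smul, LinearMap.smul_apply, mul_smul]
    congr 1
    by_cases hk0 : k = 0
    · rw [hk0, zero_smul] at h1
      rw [← h1, map_zero, smul_zero]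
    · rw [eq_inv_smul_iff₀ hk0, h1]

/-- A code cut out by eigenvalue equations of Weyl operators is a stabilizer encoding. -/
theorem exists_isStabilizerEncoding [Nontrivial E] (𝒲 : WeylSystem A G Λ) (V : E →ₗᵢ[ℂ] Hilb n G)
    (P : Set (Λ × ℂ)) (hP : ∀ φ, (∃ η, V η = φ) ↔
      ∀ p ∈ P, p.2 • toEuclideanLin (𝒲.W p.1) φ = φ) :
    ∃ (S : AddSubgroup Λ) (z : Λ → ℂ), IsStabilizerEncoding 𝒲 V S z := by
  classical
  have hex : ∀ v, ∃ k : ℂ, v ∈ scalarLabels 𝒲 V → ∀ ψ, toEuclideanLin (𝒲.W v) (V ψ) = k • V ψ := by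
    intro v
    by_cases hv : v ∈ scalarLabels 𝒲 V
    · exact ⟨hv.choose, fun _ => hv.choose_spec⟩
    · exact ⟨0, fun h => absurd h hv⟩
  choose k hk using hex
  obtain ⟨ψ₀, hψ₀⟩ := exists_ne (0 : E)
  have hψ₀' : V ψ₀ ≠ 0 := fun h0 => hψ₀ (V.injective (by rw [h0, map_zero]))
  have hk0 : ∀ v ∈ scalarLabels 𝒲 V, k v ≠ 0 := fun v hv h0 => by
    have h1 := hk v hv ψ₀
    have h2 := norm_toEuclideanLin_of_unitary (𝒲.conjTranspose_mul_W v) (V ψ₀)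
    rw [h1, h0, zero_smul, norm_zero] at h2
    exact hψ₀' (norm_eq_zero.1 h2.symm)
  -- Taking all labels that act as scalars gives a subgroup at once. It contains the labels of `P`,
  -- with phases forced by a nonzero code vector, and its further equations hold on the code by
  -- definition.
  refine ⟨scalarLabels 𝒲 V, fun v => (k v)⁻¹, fun v hv ψ => ?_, fun φ hφ => (hP φ).2 ?_⟩
  · rw [hk v hv, smul_smul, inv_mul_cancel₀ (hk0 v hv), one_smul]
  · rintro ⟨v, c⟩ hp
    have h1 : ∀ ψ, c • toEuclideanLin (𝒲.W v) (V ψ) = V ψ := fun ψ =>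
      (hP (V ψ)).1 ⟨ψ, rfl⟩ _ hp
    have hc : c ≠ 0 := by
      rintro rfl
      exact hψ₀' (by rw [← h1 ψ₀, zero_smul])
    have hv : v ∈ scalarLabels 𝒲 V := ⟨c⁻¹, fun ψ => by rw [eq_inv_smul_iff₀ hc, h1]⟩
    have h2 : c = (k v)⁻¹ := by
      have h3 := h1 ψ₀
      rw [hk v hv, smul_smul] at h3
      have h4 : c * k v = 1 := smul_left_injective ℂ hψ₀' (h3.trans (one_smul ℂ _).symm)
      exact eq_inv_of_mul_eq_one_left h4
    rw [h2]
    exact hφ v hv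

end ExistsEncoding

/-! ### Area operators of stabilizer encodings -/

section AreaOperators

variable {n : ℕ} {G : Type*} [Fintype G] [DecidableEq G]

theorem exists_diagonal {E ι : Type*} [NormedAddCommGroup E] [InnerProductSpace ℂ E] [Fintype ι]
    (B : OrthonormalBasis ι ℂ E) (f : ι → ℂ) :
    ∃ L : Module.End ℂ E, ∀ p, L (B p) = f p • B p := by
  refine ⟨B.toBasis.constr ℂ fun p => f p • B p, fun p => ?_⟩
  rw [← OrthonormalBasis.coe_toBasis, Module.Basis.constr_basis]

theorem eq_smul_one_of_basis {E ι : Type*} [NormedAddCommGroup E] [InnerProductSpace ℂ E]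
    [Fintype ι] (B : OrthonormalBasis ι ℂ E) {L : Module.End ℂ E} {s : ℂ}
    (h : ∀ p, L (B p) = s • B p) : L = s • 1 :=
  B.toBasis.ext fun p => by
    rw [OrthonormalBasis.coe_toBasis, h]
    rfl

theorem nonempty_of_orthonormalBasis {E ι : Type*} [NormedAddCommGroup E] [InnerProductSpace ℂ E]
    [Nontrivial E] [Fintype ι] (B : OrthonormalBasis ι ℂ E) : Nonempty ι := B.toBasis.index_nonempty

/-- The inclusion of a code into the physical Hilbert space. -/
noncomputable def codeInclusion (C : Submodule ℂ (Hilb n G)) : C →ₗᵢ[ℂ] Hilb n G := C.subtypeₗᵢ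

variable (C : Submodule ℂ (Hilb n G)) (A : Finset (Fin n))

theorem encodedAlgebra_codeInclusion :
    encodedAlgebra (E := C) (codeInclusion C) A = codeAlgebra C A := by
  unfold encodedAlgebra codeAlgebra
  ext T
  simp only [Set.mem_ofPred_eq]
  rfl

theorem centralizer_subset_iff (M N : Set (Module.End ℂ C)) :
    Set.centralizer M ⊆ N ↔ ∀ T : Module.End ℂ C, (∀ S ∈ M, ∀ ψ, S (T ψ) = T (S ψ)) → T ∈ N := by
  simp only [Set.subset_def, Set.mem_centralizer_iff, LinearMap.ext_iff, Module.End.mul_apply]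

variable {C A} {Λ : Type*} [AddCommGroup Λ] [Fintype Λ] {𝒲 : WeylSystem A G Λ} {S : AddSubgroup Λ}
  {z : Λ → ℂ}

theorem IsStabilizerEncoding.nonempty_recoveryDecomposition [Nontrivial C]
    (h : IsStabilizerEncoding (E := C) 𝒲 (codeInclusion C) S z) :
    Nonempty (RecoveryDecomposition C A) := by
  have hrec : ∀ T : Module.End ℂ C, (∀ S ∈ codeAlgebra C A, ∀ ψ, S (T ψ) = T (S ψ)) →
      T ∈ codeAlgebra C Aᶜ := by
    intro T hT
    rw [← encodedAlgebra_codeInclusion] at hT ⊢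
    exact IsStabilizerEncoding.complementary_recovery (E := C) h hT
  obtain ⟨r, a, b, c, d, B, UA, UB, χ, h1, h2, h3⟩ := exists_sector_decomposition (E := C)
    (codeInclusion C) A (by
      intro T hT
      rw [encodedAlgebra_codeInclusion] at hT ⊢
      exact hrec T hT)
  rw [encodedAlgebra_codeInclusion] at h1
  refine ⟨r, a, b, c, d, (centralizer_subset_iff C _ _).2 hrec, B, ?_, UA, UB, χ, ?_, ?_⟩
  · exact h1
  · exact h2
  · exact h3

/-- The four indices certify that both sectors are nonzero. A decomposition may contain empty
sectors, whose `χ` is arbitrary but does not enter the area operator. -/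
theorem IsStabilizerEncoding.entropy_recoveryDecomposition_eq [Nontrivial C] [Nonempty G]
    (h : IsStabilizerEncoding (E := C) 𝒲 (codeInclusion C) S z) (D : RecoveryDecomposition C A)
    {α β : Fin D.r} (i : Fin (D.a α)) (j : Fin (D.b α)) (i' : Fin (D.a β)) (j' : Fin (D.b β)) :
    entropy (D.χ α) = entropy (D.χ β) := by
  refine IsStabilizerEncoding.entropy_eq (E := C) h D.basis ?_ D.UA D.UB D.χ D.norm_χ ?_ i j i' j'
  · rw [encodedAlgebra_codeInclusion]
    exact D.wedderburn
  · exact D.basis_eq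

theorem RecoveryDecomposition.exists_isAreaOperator (D : RecoveryDecomposition C A) :
    ∃ L : Module.End ℂ C, IsAreaOperator C A L := by
  obtain ⟨L, hL⟩ := exists_diagonal (E := C) D.basis fun p => (entropy (D.χ p.1) : ℂ)
  exact ⟨L, D, fun α i j => hL ⟨α, (i, j)⟩⟩

theorem IsStabilizerEncoding.eq_smul_one_of_isAreaOperator [Nontrivial C] [Nonempty G]
    (h : IsStabilizerEncoding (E := C) 𝒲 (codeInclusion C) S z) {L : Module.End ℂ C}
    (hL : IsAreaOperator C A L) : ∃ s : ℂ, L = s • (1 : Module.End ℂ C) := by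
  obtain ⟨D, hD⟩ := hL
  obtain ⟨⟨α, i, j⟩⟩ := nonempty_of_orthonormalBasis (E := C) D.basis
  refine ⟨entropy (D.χ α), eq_smul_one_of_basis (E := C) D.basis ?_⟩
  rintro ⟨β, i', j'⟩
  rw [h.entropy_recoveryDecomposition_eq D i j i' j']
  exact hD β i' j'

end AreaOperators

/-! ### Codes with trivial non-local magic -/

section TrivialMagic

variable {n : ℕ} {G : Type*} [AddCommGroup G] [Fintype G] [DecidableEq G]

/-- Over a union of blocks, a code without non-local magic is a stabilizer encoding for a
conjugate of the Pauli operators. -/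
theorem HasTrivialNonlocalMagic.exists_isStabilizerEncoding {C : Submodule ℂ (Hilb n G)}
    [Nontrivial C] {K : Finpartition (Finset.univ : Finset (Fin n))}
    (hK : HasTrivialNonlocalMagic K C) {KA : Finset (Finset (Fin n))} (hKA : KA ⊆ K.parts)
    {A : Finset (Fin n)} (hA : A = KA.biUnion id) :
    ∃ (𝒲 : WeylSystem A G ((Fin n → G) × (Fin n → AddChar G ℂ)))
      (S : AddSubgroup ((Fin n → G) × (Fin n → AddChar G ℂ)))
      (z : (Fin n → G) × (Fin n → AddChar G ℂ) → ℂ),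
      IsStabilizerEncoding (E := C) 𝒲 (codeInclusion C) S z := by
  obtain ⟨U, hU, 𝒮, hpauli, -, hC⟩ := hK
  obtain ⟨UA, UB, hUA, hUB, hUU⟩ := exists_tensorOver_eq_loc K U
    (fun B hB => Matrix.mem_unitaryGroup_iff.1 (hU B hB)) hKA hA
  set W := tensorOver K U with hW
  have hWW : Wᴴ * W = 1 := by
    rw [hUU, loc_conjTranspose, loc_mul_loc, mul_eq_one_comm.1 hUA, mul_eq_one_comm.1 hUB,
      loc_one_one]
  have hWW' : ∀ φ, toEuclideanLin Wᴴ (toEuclideanLin W φ) = φ := fun φ => by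
    rw [← toEuclideanLin_mul_apply, hWW, toEuclideanLin, toLpLin_one]
    rfl
  have hWW'' : ∀ φ, toEuclideanLin W (toEuclideanLin Wᴴ φ) = φ := fun φ => by
    rw [← toEuclideanLin_mul_apply, mul_eq_one_comm.1 hWW, toEuclideanLin, toLpLin_one]
    rfl
  let P : Set (((Fin n → G) × (Fin n → AddChar G ℂ)) × ℂ) :=
    {p | ∃ g ∈ 𝒮, (g : Matrix (Fin n → G) (Fin n → G) ℂ) = p.2 • pauli p.1.1 p.1.2}
  refine ⟨(pauliSystem A G).conjugate hUA hUB, QCode.exists_isStabilizerEncoding (E := C) _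
    (codeInclusion C) P fun φ => ?_⟩
  have h1 : (∃ η : C, codeInclusion C η = φ) ↔ φ ∈ C :=
    ⟨fun ⟨η, hη⟩ => hη ▸ η.2, fun hφ => ⟨⟨φ, hφ⟩, rfl⟩⟩
  have h2 : φ ∈ C ↔ toEuclideanLin W φ ∈ C.map (toEuclideanLin W) := by
    refine ⟨fun hφ => ⟨φ, hφ, rfl⟩, ?_⟩
    rintro ⟨φ', hφ', h⟩
    rwa [← hWW' φ, ← h, hWW']
  -- A Pauli eigenvalue equation for `W φ` is the equation of the conjugated operator for `φ`, so
  -- the stabilizer pulls back to the original code.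
  have h3 : ∀ p : ((Fin n → G) × (Fin n → AddChar G ℂ)) × ℂ,
      p.2 • toEuclideanLin (((pauliSystem A G).conjugate hUA hUB).W p.1) φ = φ ↔
        toEuclideanLin (p.2 • pauli p.1.1 p.1.2) (toEuclideanLin W φ) = toEuclideanLin W φ := by
    intro p
    rw [WeylSystem.conjugate_W, pauliSystem_W, ← hUU, toEuclideanLin_mul_apply,
      toEuclideanLin_mul_apply, ← map_smul, ← LinearMap.smul_apply, ← map_smul]
    constructor
    · intro h
      rw [← hWW'' (toEuclideanLin _ _), h]
    · intro h
      rw [h, hWW']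
  rw [h1, h2, hC]
  constructor
  · rintro h p ⟨g, hg, hgp⟩
    rw [h3, ← hgp]
    exact h g hg
  · intro h g hg
    obtain ⟨c, a, χ, -, hg'⟩ := hpauli g hg
    have := (h3 ((a, χ), c)).1 (h _ ⟨g, hg, hg'⟩)
    rwa [hg']

end TrivialMagic

end QCode

theorem mainTheorem4 {n : ℕ} {G : Type*} [AddCommGroup G] [Fintype G] [DecidableEq G]
    (C : Submodule ℂ (QCode.Hilb n G)) (hC : C ≠ ⊥)
    (K : Finpartition (Finset.univ : Finset (Fin n)))
    (hK : QCode.HasTrivialNonlocalMagic K C)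
    (KA : Finset (Finset (Fin n))) (hKA : KA ⊆ K.parts)
    (A : Finset (Fin n)) (hA : A = KA.biUnion id) :
    (∃ L : Module.End ℂ C, QCode.IsAreaOperator C A L) ∧
      ∀ L : Module.End ℂ C, QCode.IsAreaOperator C A L →
        ∃ s : ℂ, L = s • (1 : Module.End ℂ C) := by
  have : Nontrivial C := Submodule.nontrivial_iff_ne_bot.2 hC
  obtain ⟨𝒲, S, z, h⟩ := hK.exists_isStabilizerEncoding hKA hA
  obtain ⟨D⟩ := h.nonempty_recoveryDecomposition
  exact ⟨D.exists_isAreaOperator, fun L hL => h.eq_smul_one_of_isAreaOperator hL⟩
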